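/- **Setting.** Let $d\ge 0$, $n\ge 1$, $X\subseteq\mathbb R^m$, $f=(f_1,\dots,f_d):\mathbb R^m\to\mathbb R^d$ and $\phi:\mathbb R^d\to\mathbb R$. For each $i$ let $a_{i0}<\dots<a_{in}$ be reals and $0=\tau(i,0)<\dots<\tau(i,l_i)=n$ integers. Let $u_{ij}:\mathbb R^m\to\mathbb R$ ($0\le j\le n$) satisfy, for all $x\in X$, $u_{ij}(x)\le\min\{f_i(x),a_{ij}\}$, $u_{i0}(x)=a_{i0}$, $u_{in}(x)=f_i(x)$. Let $W\subseteq\mathbb R^m\times\mathbb R^d$ be convex with $(x,f(x))\in W$ for all $x\in X$. Write $s=(s_{ij})$, $z=(z_{ij})$ for vectors in $\mathbb R^{d\times(n+1)}$, $s_{\cdot n}=(s_{1n},\dots,s_{dn})$, $\bar\phi(s)=\phi(s_{\cdot n})$. For a function $g$ on a convex set $S$, $\operatorname{conc}_S(g)(p)=\sup\{r: (p,r)\in\operatorname{conv}\{(q,\rho): q\in S,\ \rho\le g(q)\}\}\in[-\infty,\infty]$ is its concave envelope. Let $\bar\Delta$ be the set of $(z,\delta)$, $\delta=(\delta_{ik})_{0\le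 k\le l_i}$, with $1=z_{i0}\ge z_{i1}\ge\dots\ge z_{in}\ge0$, $\delta_{i0}=1$, $\delta_{il_i}=0$ and $z_{i\tau(i,t)}\ge\delta_{it}\ge z_{i,\tau(i,t)+1}$ for $1\le t\le l_i-1$. For a vector $c=(c_{ij})$ nondecreasing in $j$ let $Q(c)=\prod_i\operatorname{conv}\{(c_{i0},\dots,c_{i,j-1},c_{ij},\dots,c_{ij}):0\le j\le n\}$, and put $Q=Q(a)$. **Local bounds.** Given real coefficients $b_{ijk}$ ($0\le j\le n$, $0\le k\le l_i$), put $a'_{ij}(\delta)=a_{i0}+\sum_{k=0}^{l_i}b_{ijk}\delta_{ik}$, and for $1\le t\le l_i$ let $a^t_{ij}=a_{i0}+\sum_{k=0}^{t-1}b_{ijk}$ be its value when $\delta_{ik}=1$ for $k<t$ and $\delta_{ik}=0$ for $k\ge t$. Assume, for all $i$: 1. $b_{ink}=a_{i\tau(i,k+1)}-a_{i\tau(i,k)}$ for $0\le k<l_i$; $b_{i00}=0$ and $b_{i0k}=a_{i\tau(i,k)}-a_{i\tau(i,k-1)}$ for $1\le k\le l_i$; 2. $a^t_{ij'}\le a^t_{ij}$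 for $0\le j'\le j\le n$ and $1\le t\le l_i$; 3. if $x\in X$ and $f_i(x)\in(a_{i\tau(i,t-1)},a_{i\tau(i,t)}]$, then $u_{ij}(x)\le a^t_{ij}$ for all $j$, and $f_i(x)\le a^t_{i\tau(i,t)}$; 4. $a^t_{ij}\le\max\{a_{ij},a_{i\tau(i,t-1)}\}$ for all $j$ and $1\le t\le l_i$. Let $G$ be the affine map $$G_{ij}(z,\delta)=a_{i0}+\sum_{j'=1}^{j}z_{ij'}\sum_{k:\,\tau(i,k)<j'}(b_{ij'k}-b_{i,j'-1,k})+\sum_{k=0}^{l_i}\delta_{ik}\,b_{i,\min\{\tau(i,k),j\},k}.$$ Let $R_+$ be the set of $(x,y,s,z,\delta)$ with $$y\le\operatorname{conc}_{\bar\Delta}(\bar\phi\circ G)(z,\delta),\quad s=G(z,\delta),\quad (z,\delta)\in\bar\Delta,\quad u(x)\le s,\quad (x,s_{\cdot n})\in W,$$ and let $E_+$ be the set of its points with binary $\delta$. Let $E$ be the set of $(x,y,s,\delta)$ with $\delta$ binary, $y\le\operatorname{conc}_Q(\bar\phi)(s)$, $u(x)\le s$, $(x,s_{\cdot n})\in W$,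 and $s_{ij}=a_{i0}z_{i0}+\sum_{k=1}^j(a_{ik}-a_{i,k-1})z_{ik}$ for some $z$ with $(z,\delta)\in\bar\Delta$. For $(\bar x,\bar f)\in W$ let $\phi_{\mathcal H_+}(\bar x,\bar f)$, resp. $\phi_{\mathcal H}(\bar x,\bar f)$, be the supremum in $[-\infty,\infty]$ of all $y$ that occur in a point of $E_+$, resp. $E$, with $x=\bar x$ and $s_{\cdot n}=\bar f$ ($\sup\emptyset=-\infty$). **Theorem.** (a) $E_+$ is a mixed-integer relaxation of the hypograph of $\phi\circ f$: for all $x\in X$ and $y\le\phi(f(x))$ there are $s,z,\delta$ with $(x,y,s,z,\delta)\in E_+$. If all $u_{ij}$ are convex on the projection of $W$ to $\mathbb R^m$, then the continuous relaxation $R_+$ is convex, so that $E_+$ is an MICP relaxation. (b) Let $(\bar x,\bar f)\in W$ and let $t=(t_1,\dots,t_d)$, $1\le t_i\le l_i$, be such that $\bar f_i\in[a_{i\tau(i,t_i-1)},a_{i\tau(i,t_i)}]$ for all $i$. Put $a'_{ij}=a^{t_i}_{ij}$, $Q'=Q(a')$, and assume that $(\bar x,\bar f)$ is compatible with $t$: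 $u_{ij}(\bar x)\le\min\{a'_{ij},\bar f_i\}$ and $\bar f_i\le a'_{i\tau(i,t_i)}$ for all $i,j$. Let $\tilde u_i=\bar u_i\vee\hat u_i$ (componentwise maximum), where $\bar u_{in}=\bar f_i$, $\bar u_{ij}=u_{ij}(\bar x)$ for $j<n$, and $\hat u_{ij}=a'_{ij}$ for $j\le\tau(i,t_i-1)$, $\hat u_{ij}=\bar f_i$ for $j\ge\tau(i,t_i)$, $\hat u_{ij}=-\infty$ otherwise. Let $s'_{ij}$ be the value at $a'_{ij}$ of the concave envelope of the discrete function that takes the value $\tilde u_{ij'}$ at $a'_{ij'}$ for $0\le j'\le n$ (the largest one if points coincide) and $-\infty$ elsewhere. Then the $s'_{ij}$ are real and $$\phi_{\mathcal H_+}(\bar x,\bar f)=\operatorname{conc}_{Q'}(\bar\phi)(s'),$$ and the supremum is a maximum whenever this value is finite. If $(\bar x,\bar f)\in W$ is compatible with no such $t$, then $E_+$ has no point with $x=\bar x$, $s_{\cdot n}=\bar f$. (c) If $(\bar x,\bar f)\in W$ and $u_{ij}(\bar x)\le a_{ij}$ for all $i,j$ (which holds if $\bar x\in X$), then $\phi_{\mathcal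 H_+}(\bar x,\bar f)\le\phi_{\mathcal H}(\bar x,\bar f)$. -/

import Mathlib

/-- The concave envelope determined by a hypograph `A`: the value at `p` is the supremum of the
heights `r` with `(p, r)` in the convex hull of `A`; it is `⊥` where the hull has no point
above `p`. -/
noncomputable def envelope {E : Type*} [AddCommGroup E] [Module ℝ E]
    (A : Set (E × ℝ)) (p : E) : EReal :=
  sSup ((fun r : ℝ => (r : EReal)) '' {r : ℝ | (p, r) ∈ convexHull ℝ A})

/-- `conc_S(g)`: the concave envelope of `g` over `S` (`⊥` outside the convex hull of `S`). -/
noncomputable def concOn {E : Type*} [AddCommGroup E] [Module ℝ E]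
    (S : Set E) (g : E → ℝ) : E → EReal :=
  envelope {q : E × ℝ | q.1 ∈ S ∧ q.2 ≤ g q.1}

/-- `conc(ξ_a)(· ; v)`: the concave envelope of the discrete function `ξ_a(· ; v)` which is `v j`
at the point `a j` and `⊥` elsewhere. If a point is repeated among the `a j`, the largest of the
values attached to it counts. Entries `v j = ⊥` impose nothing. -/
noncomputable def concDiscrete {n : ℕ} (a : Fin (n + 1) → ℝ) (v : Fin (n + 1) → EReal) :
    ℝ → EReal :=
  envelope {q : ℝ × ℝ | ∃ j, q.1 = a j ∧ (q.2 : EReal) ≤ v j}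

/-- The simplotope `Q = ∏ i, Q_i`, where `Q_i` is the convex hull of the points
`v_ij = (a_i0, …, a_ij, a_ij, …, a_ij)`, `j = 0, …, n`. -/
def simplotope {d n : ℕ} (a : Fin d → Fin (n + 1) → ℝ) : Set (Fin d → Fin (n + 1) → ℝ) :=
  {s | ∀ i, s i ∈ convexHull ℝ (Set.range fun j j' : Fin (n + 1) => a i (min j j'))}

/-- `φ̄(s) = φ(s_{1n}, …, s_{dn})`. -/
def liftLast {d n : ℕ} (φ : (Fin d → ℝ) → ℝ) (s : Fin d → Fin (n + 1) → ℝ) : ℝ :=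
  φ fun i => s i (Fin.last n)

/-- A discretization scheme: points `a_i0 < ⋯ < a_in` for each coordinate `i`, and a subsequence
of breakpoints with indices `0 = τ(i,0) < ⋯ < τ(i,l_i) = n`. The `i`-th coordinate of the subcubes
are the intervals `[a_{iτ(i,t)}, a_{iτ(i,t+1)}]`, numbered here by `t : Fin (l i)`. -/
structure DiscretizationScheme (d n : ℕ) where
  a : Fin d → Fin (n + 1) → ℝ
  l : Fin d → ℕ
  τ : (i : Fin d) → Fin (l i + 1) → Fin (n + 1)
  a_strictMono : ∀ i, StrictMono (a i)
  τ_strictMono : ∀ i, StrictMono (τ i)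
  τ_zero : ∀ i, τ i 0 = 0
  τ_last : ∀ i, τ i (Fin.last (l i)) = Fin.last n

/-- The ordering conditions between the underestimators `u`, the bounds `a` and the inner
functions `f` on `X` (the range of `f i` is contained in `[a_i0, a_in]` as a consequence). -/
structure OrderedOA {m d n : ℕ} (X : Set (Fin m → ℝ)) (f : (Fin m → ℝ) → Fin d → ℝ)
    (a : Fin d → Fin (n + 1) → ℝ) (u : Fin d → Fin (n + 1) → (Fin m → ℝ) → ℝ) : Prop where
  le_inner : ∀ x ∈ X, ∀ i j, u i j x ≤ f x i
  le_bound : ∀ x ∈ X, ∀ i j, u i j x ≤ a i j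
  first : ∀ x ∈ X, ∀ i, u i 0 x = a i 0
  last : ∀ x ∈ X, ∀ i, u i (Fin.last n) x = f x i

namespace DiscretizationScheme

variable {d n : ℕ} (D : DiscretizationScheme d n)

/-- The space of the variables `z = (z_ij)` and of `s = (s_ij)`. -/
abbrev ZVar (_D : DiscretizationScheme d n) : Type := Fin d → Fin (n + 1) → ℝ

/-- The space of the variables `δ = (δ_ik)`, `k = 0, …, l_i`; the entries `δ_i0 = 1` and
`δ_{i l_i} = 0` are carried along as fixed coordinates. -/
abbrev DVar : Type := (i : Fin d) → Fin (D.l i + 1) → ℝ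

/-- The polytope `Δ̄`: the continuous relaxation of the incremental model. -/
def deltaBar : Set (D.ZVar × D.DVar) :=
  {p | ∀ i,
    p.1 i 0 = 1 ∧ Antitone (p.1 i) ∧ 0 ≤ p.1 i (Fin.last n) ∧
    p.2 i 0 = 1 ∧ p.2 i (Fin.last (D.l i)) = 0 ∧
    ∀ t : Fin (D.l i + 1), t ≠ 0 → t ≠ Fin.last (D.l i) →
      p.2 i t ≤ p.1 i (D.τ i t) ∧
      ∀ j : Fin (n + 1), (j : ℕ) = (D.τ i t : ℕ) + 1 → p.1 i j ≤ p.2 i t}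

/-- Binary vectors `δ`. -/
def IsBinary (δ : D.DVar) : Prop := ∀ i k, δ i k = 0 ∨ δ i k = 1

/-- The affine map `Z⁻¹` (for the bounds `a`):
`s_ij = a_i0 z_i0 + ∑_{1 ≤ j' ≤ j} (a_ij' - a_{i,j'-1}) z_ij'`. -/
def zInv (z : D.ZVar) : D.ZVar := fun i j =>
  D.a i 0 * z i 0 +
    ∑ q : Fin n, if q.succ ≤ j then (D.a i q.succ - D.a i q.castSucc) * z i q.succ else 0

/-- Coefficients `b_ijk`. The entries with `k = l_i` never matter, since `δ_{i l_i} = 0`. -/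
abbrev Coeff : Type := (i : Fin d) → Fin (n + 1) → Fin (D.l i + 1) → ℝ

/-- The local bounds `a'_ij(δ) = a_i0 + ∑_k b_ijk δ_ik`. -/
def localBound (b : D.Coeff) (δ : D.DVar) : Fin d → Fin (n + 1) → ℝ := fun i j =>
  D.a i 0 + ∑ k, b i j k * δ i k

/-- The value of `a'_ij` on the `t`-th interval of coordinate `i`, where `δ_i0 = ⋯ = δ_it = 1` and
the later entries of `δ_i` vanish: `a_i0 + ∑_{k ≤ t} b_ijk`. -/
def boundOn (b : D.Coeff) (i : Fin d) (j : Fin (n + 1)) (t : Fin (D.l i)) : ℝ :=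
  D.a i 0 + ∑ k ∈ Finset.Iic t.castSucc, b i j k

/-- The affine map `G`. The condition `τ(i,k) < j'` says that `k < θ(i,j')`, where
`θ(i,j') = min {k | τ(i,k) ≥ j'}`. -/
def G (b : D.Coeff) (p : D.ZVar × D.DVar) : D.ZVar := fun i j =>
  D.a i 0 +
    (∑ q : Fin n, if q.succ ≤ j then
        p.1 i q.succ * ∑ k, (if D.τ i k < q.succ then b i q.succ k - b i q.castSucc k else 0)
      else 0) +
    ∑ k, p.2 i k * b i (min (D.τ i k) j) k

/-- `v` lies in the half-open `t`-th interval `(a_{iτ(i,t)}, a_{iτ(i,t+1)}]`. -/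
def InPiece (i : Fin d) (t : Fin (D.l i)) (v : ℝ) : Prop :=
  D.a i (D.τ i t.castSucc) < v ∧ v ≤ D.a i (D.τ i t.succ)

/-- The requirements on the coefficients `b` of the local bounds. -/
structure IsAdmissible {m : ℕ} (X : Set (Fin m → ℝ)) (f : (Fin m → ℝ) → Fin d → ℝ)
    (u : Fin d → Fin (n + 1) → (Fin m → ℝ) → ℝ) (b : D.Coeff) : Prop where
  /-- `b_ink = a_{iτ(i,k+1)} - a_{iτ(i,k)}` -/
  last : ∀ i (k : Fin (D.l i)),
    b i (Fin.last n) k.castSucc = D.a i (D.τ i k.succ) - D.a i (D.τ i k.castSucc)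
  /-- `b_i0k = a_{iτ(i,k)} - a_{iτ(i,k-1)}` for `k ≥ 1`, and `b_i00 = 0` -/
  first_zero : ∀ i, b i 0 0 = 0
  first_succ : ∀ i (k : Fin (D.l i)),
    b i 0 k.succ = D.a i (D.τ i k.succ) - D.a i (D.τ i k.castSucc)
  /-- the local bounds are nondecreasing in `j` -/
  mono : ∀ i (t : Fin (D.l i)) (j' j : Fin (n + 1)), j' ≤ j →
    ∑ k ∈ Finset.Iic t.castSucc, b i j' k ≤ ∑ k ∈ Finset.Iic t.castSucc, b i j k
  /-- the local bounds are bounds of the underestimators -/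
  under_le : ∀ x ∈ X, ∀ i (t : Fin (D.l i)), D.InPiece i t (f x i) →
    ∀ j, u i j x ≤ D.boundOn b i j t
  /-- on the `t`-th interval, the bound at the right breakpoint is a bound of `f i` -/
  inner_le : ∀ x ∈ X, ∀ i (t : Fin (D.l i)), D.InPiece i t (f x i) →
    f x i ≤ D.boundOn b i (D.τ i t.succ) t
  /-- local bounds are at least as tight as the global ones (or as the end of the interval) -/
  le_global : ∀ i (t : Fin (D.l i)) j,
    D.boundOn b i j t ≤ max (D.a i j) (D.a i (D.τ i t.castSucc))

/-- The continuous relaxation of the tightened formulation, in the variables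
`(x, φ, s, z, δ)`: `y ≤ conc_Δ̄(φ̄ ∘ G)(z,δ)`, `s = G(z,δ)`, `(z,δ) ∈ Δ̄`, `u(x) ≤ s`,
`(x, s_{·n}) ∈ W`. -/
def tightContinuous {m : ℕ} (φ : (Fin d → ℝ) → ℝ) (u : Fin d → Fin (n + 1) → (Fin m → ℝ) → ℝ)
    (b : D.Coeff) (W : Set ((Fin m → ℝ) × (Fin d → ℝ))) :
    Set ((Fin m → ℝ) × ℝ × D.ZVar × D.ZVar × D.DVar) :=
  {w | match w with
    | (x, y, s, z, δ) =>
      (y : EReal) ≤ concOn D.deltaBar (fun p => liftLast φ (D.G b p)) (z, δ) ∧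
      s = D.G b (z, δ) ∧ (z, δ) ∈ D.deltaBar ∧ (∀ i j, u i j x ≤ s i j) ∧
      (x, fun i => s i (Fin.last n)) ∈ W}

/-- The tightened mixed-integer formulation: `δ` is binary. -/
def tight {m : ℕ} (φ : (Fin d → ℝ) → ℝ) (u : Fin d → Fin (n + 1) → (Fin m → ℝ) → ℝ)
    (b : D.Coeff) (W : Set ((Fin m → ℝ) × (Fin d → ℝ))) :
    Set ((Fin m → ℝ) × ℝ × D.ZVar × D.ZVar × D.DVar) :=
  {w | w ∈ D.tightContinuous φ u b W ∧ D.IsBinary w.2.2.2.2}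

/-- The formulation with the global bounds `a`, in the variables `(x, φ, s, δ)`:
`y ≤ conc_Q(φ̄)(s)`, `s = Z⁻¹(z)`, `(z,δ) ∈ Δ̄` with `δ` binary, `u(x) ≤ s`, `(x, s_{·n}) ∈ W`. -/
def base {m : ℕ} (φ : (Fin d → ℝ) → ℝ) (u : Fin d → Fin (n + 1) → (Fin m → ℝ) → ℝ)
    (W : Set ((Fin m → ℝ) × (Fin d → ℝ))) :
    Set ((Fin m → ℝ) × ℝ × D.ZVar × D.DVar) :=
  {w | match w with
    | (x, y, s, δ) =>
      (y : EReal) ≤ concOn (simplotope D.a) (liftLast φ) s ∧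
      (∃ z, s = D.zInv z ∧ (z, δ) ∈ D.deltaBar) ∧ D.IsBinary δ ∧ (∀ i j, u i j x ≤ s i j) ∧
      (x, fun i => s i (Fin.last n)) ∈ W}

/-- The `φ`-values of the points of the tightened formulation over `(x̄, f̄)`. -/
def tightValues {m : ℕ} (φ : (Fin d → ℝ) → ℝ) (u : Fin d → Fin (n + 1) → (Fin m → ℝ) → ℝ)
    (b : D.Coeff) (W : Set ((Fin m → ℝ) × (Fin d → ℝ))) (x : Fin m → ℝ) (g : Fin d → ℝ) : Set ℝ :=
  {y | ∃ s z δ, (x, y, s, z, δ) ∈ D.tight φ u b W ∧ ∀ i, s i (Fin.last n) = g i}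

/-- The `φ`-values of the points of the formulation with global bounds over `(x̄, f̄)`. -/
def baseValues {m : ℕ} (φ : (Fin d → ℝ) → ℝ) (u : Fin d → Fin (n + 1) → (Fin m → ℝ) → ℝ)
    (W : Set ((Fin m → ℝ) × (Fin d → ℝ))) (x : Fin m → ℝ) (g : Fin d → ℝ) : Set ℝ :=
  {y | ∃ s δ, (x, y, s, δ) ∈ D.base φ u W ∧ ∀ i, s i (Fin.last n) = g i}

/-- The supremum, as an extended real number, of a set of real numbers. -/
noncomputable def supValue (A : Set ℝ) : EReal := sSup ((fun r : ℝ => (r : EReal)) '' A)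

/-- A choice of one interval for each coordinate, that is, of one subcube. -/
abbrev BoxIndex : Type := (i : Fin d) → Fin (D.l i)

/-- `g` lies in the (closed) subcube number `t`. -/
def InBox (t : D.BoxIndex) (g : Fin d → ℝ) : Prop :=
  ∀ i, D.a i (D.τ i (t i).castSucc) ≤ g i ∧ g i ≤ D.a i (D.τ i (t i).succ)

/-- The binary vector that selects the subcube `t`. -/
def boxDelta (t : D.BoxIndex) : D.DVar := fun i k => if k ≤ (t i).castSucc then 1 else 0

/-- The vector `ũ = ū ∨ û`, where `ū_in = f̄_i`, `ū_ij = u_ij(x̄)` for `j < n`, and `û_ij` is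
`a'_ij` up to the left breakpoint of the interval, `f̄_i` from the right breakpoint on, and `⊥`
in between. -/
noncomputable def uTilde {m : ℕ} (u : Fin d → Fin (n + 1) → (Fin m → ℝ) → ℝ)
    (a' : Fin d → Fin (n + 1) → ℝ) (t : D.BoxIndex) (x : Fin m → ℝ) (g : Fin d → ℝ)
    (i : Fin d) (j : Fin (n + 1)) : EReal :=
  max (if j = Fin.last n then (g i : EReal) else (u i j x : EReal))
    (if j ≤ D.τ i (t i).castSucc then (a' i j : EReal)
      else if D.τ i (t i).succ ≤ j then (g i : EReal) else ⊥)

/-- The subcube `t` contains `f̄`, and `f̄` and the underestimators at `x̄` respect the local bounds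
`a'` of this subcube. -/
def IsCompatible {m : ℕ} (u : Fin d → Fin (n + 1) → (Fin m → ℝ) → ℝ)
    (a' : Fin d → Fin (n + 1) → ℝ) (t : D.BoxIndex) (x : Fin m → ℝ) (g : Fin d → ℝ) : Prop :=
  D.InBox t g ∧ (∀ i, g i ≤ a' i (D.τ i (t i).succ)) ∧ ∀ i j, u i j x ≤ min (a' i j) (g i)

end DiscretizationScheme

/-! A point `s` of one factor of the simplotope with nodes `c` encodes a random variable `ξ` on the
nodes through `s_j = E min(ξ, c_j)`; the last entry is the mean of `ξ`, and `s` is the restriction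
of the concave function `p ↦ E min(ξ, p)`. With the mean fixed, a smaller `s` means a more spread
out `ξ`. The core is a discrete Strassen theorem, `exists_isSpread`: if `s' ≤ s` is concave along
the nodes and has the same ends, then some linear map sends `s` to `s'`, maps the chain into itself
and keeps all means. Such a map, applied in each coordinate to a convex combination representing
`(s, r)` below the graph of `φ̄`, gives one for `(s', r)`, because `φ̄` sees only means. So the
envelope can only grow as `s` decreases, and over a fixed `f̄` and a fixed box its supremum sits at
the least feasible `s`. That least point is the concave envelope of the values that feasibility
forces (`exists_least_chain`).

The rest reduces the formulation to this picture. A binary `δ` selects a box and a face of `Δ̄`. A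
hull restricted to a face uses only points of the face (`mem_convexHull_inter_face`), and there `G`
is the incremental map for the local bounds (`G_boxDelta`). This map has the affine section
`slopesOn` over the matching face of the simplotope, so hulls can be transported both ways
(`concOn_deltaBar_le`, `concOn_simplotope_le`). If `f̄` lies in several boxes, they differ only in
coordinates where `f̄_i` is an extreme value of the last entry; such a coordinate can be replaced by
a constant (`concOn_simplotope_le_of_least`).

For the comparison with the global bounds, the law of `ξ` on the local bounds is kept and `E min(ξ,
a_j)` is recomputed at the global ones. The mean is unchanged, and no underestimator constraint is
lost. -/

/-! ### Faces of convex hulls and concave envelopes. -/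

/-- A convex hull meets a face of a convex superset only in the hull of the points of the face. -/
theorem mem_convexHull_inter_face {V : Type*} [AddCommGroup V] [Module ℝ V] {A C F : Set V}
    (hC : Convex ℝ C) (hAC : A ⊆ C)
    (hF : ∀ x ∈ C, ∀ y ∈ C, ∀ α β : ℝ, 0 < α → 0 < β → α + β = 1 →
      α • x + β • y ∈ F → x ∈ F ∧ y ∈ F) {v : V} (hv : v ∈ convexHull ℝ A) (hvF : v ∈ F) :
    v ∈ convexHull ℝ (A ∩ F) := by
  -- Membership in `C` is carried along so that the face property makes this set convex.
  have key : convexHull ℝ A ⊆ {w | w ∈ C ∧ (w ∈ F → w ∈ convexHull ℝ (A ∩ F))} := by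
    refine convexHull_min (fun w hw => ⟨hAC hw, fun h => subset_convexHull ℝ _ ⟨hw, h⟩⟩) ?_
    rw [convex_iff_forall_pos]
    rintro x ⟨hx, hx'⟩ y ⟨hy, hy'⟩ α β hα hβ hαβ
    refine ⟨hC hx hy hα.le hβ.le hαβ, fun h => ?_⟩
    obtain ⟨h1, h2⟩ := hF x hx y hy α β hα hβ hαβ h
    exact convex_convexHull ℝ _ (hx' h1) (hy' h2) hα.le hβ.le hαβ
  exact (key hv).2 hvF

/-- A map that respects convex combinations. -/
def PreservesMix {E F : Type*} [AddCommGroup E] [Module ℝ E] [AddCommGroup F] [Module ℝ F]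
    (Λ : E → F) : Prop :=
  ∀ (x y : E) (α β : ℝ), α + β = 1 → Λ (α • x + β • y) = α • Λ x + β • Λ y

/-- All comparisons of envelopes transport hull points by such a map at constant height. Affinity
suffices, and linearity would be too much: the maps used have constant components. -/
theorem mem_convexHull_of_preservesMix {E F : Type*} [AddCommGroup E] [Module ℝ E]
    [AddCommGroup F] [Module ℝ F] {Λ : E → F} (hΛ : PreservesMix Λ) {A : Set (E × ℝ)}
    {B : Set (F × ℝ)} (h : ∀ w ∈ A, (Λ w.1, w.2) ∈ B) {p : E} {r : ℝ}
    (hp : (p, r) ∈ convexHull ℝ A) : (Λ p, r) ∈ convexHull ℝ B := by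
  have key : convexHull ℝ A ⊆ {w | (Λ w.1, w.2) ∈ convexHull ℝ B} := by
    refine convexHull_min (fun w hw => subset_convexHull ℝ _ (h w hw)) ?_
    rintro x hx y hy α β hα hβ hαβ
    have := convex_convexHull ℝ B hx hy hα hβ hαβ
    simp only [Set.mem_ofPred_eq, Prod.fst_add, Prod.snd_add, Prod.smul_fst, Prod.smul_snd,
      hΛ _ _ _ _ hαβ]
    exact this
  exact key hp

theorem le_envelope_of_mem {E : Type*} [AddCommGroup E] [Module ℝ E] {A : Set (E × ℝ)} {p : E}
    {r : ℝ} (h : (p, r) ∈ convexHull ℝ A) : (r : EReal) ≤ envelope A p :=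
  le_sSup ⟨r, h, rfl⟩

theorem envelope_le_envelope {E F : Type*} [AddCommGroup E] [Module ℝ E]
    [AddCommGroup F] [Module ℝ F] {A : Set (E × ℝ)} {B : Set (F × ℝ)} {p : E} {q : F}
    (h : ∀ r : ℝ, (p, r) ∈ convexHull ℝ A → (q, r) ∈ convexHull ℝ B) :
    envelope A p ≤ envelope B q := by
  refine sSup_le ?_
  rintro _ ⟨r, hr, rfl⟩
  exact le_envelope_of_mem (h r hr)

/-- Envelopes are concave. -/
theorem envelope_concave {E : Type*} [AddCommGroup E] [Module ℝ E] {A : Set (E × ℝ)} {p q : E}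
    {y y' α β : ℝ} (hα : 0 ≤ α) (hβ : 0 ≤ β) (hαβ : α + β = 1)
    (hp : (y : EReal) ≤ envelope A p) (hq : (y' : EReal) ≤ envelope A q) :
    ((α * y + β * y' : ℝ) : EReal) ≤ envelope A (α • p + β • q) := by
  have approx : ∀ (p : E) (y ε : ℝ), 0 < ε → (y : EReal) ≤ envelope A p →
      ∃ r : ℝ, (p, r) ∈ convexHull ℝ A ∧ y - ε < r := by
    intro p y ε hε h
    have : ((y - ε : ℝ) : EReal) < envelope A p :=
      lt_of_lt_of_le (EReal.coe_lt_coe_iff.2 (by linarith)) h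
    obtain ⟨_, ⟨r, hr, rfl⟩, h2⟩ := lt_sSup_iff.1 this
    exact ⟨r, hr, EReal.coe_lt_coe_iff.1 h2⟩
  refine EReal.ge_of_forall_gt_iff_ge.1 fun z hz => ?_
  have hz' := EReal.coe_lt_coe_iff.1 (show ((z : ℝ) : EReal) < _ from hz)
  obtain ⟨r, hr, h1⟩ := approx p y _ (sub_pos.2 hz') hp
  obtain ⟨r', hr', h2⟩ := approx q y' _ (sub_pos.2 hz') hq
  have h3 := convex_convexHull ℝ A hr hr' hα hβ hαβ
  refine le_trans ?_ (le_envelope_of_mem (r := α * r + β * r') h3)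
  refine EReal.coe_le_coe_iff.2 ?_
  -- Both heights are approximated with the same slack `α y + β y' - z`, so that the weighted lower
  -- bounds add up to exactly `z`. Approximation is needed because the suprema may be infinite or
  -- not attained.
  have e : z = α * (y - (α * y + β * y' - z)) + β * (y' - (α * y + β * y' - z)) := by
    have : β = 1 - α := by linarith
    subst this; ring
  rw [e]
  gcongr

/-! ### One factor of the simplotope: concavity along the nodes and mean-preserving spreads. -/

section Chain

variable {n : ℕ}

/-- The points `(c_0, …, c_m, c_m, …, c_m)`. -/
def stair (c : Fin (n + 1) → ℝ) (m j : Fin (n + 1)) : ℝ := c (min m j)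

/-- The convex hull of the points `(c_0, …, c_m, c_m, …, c_m)`, a factor of the simplotope. -/
def chain (c : Fin (n + 1) → ℝ) : Set (Fin (n + 1) → ℝ) := convexHull ℝ (Set.range (stair c))

theorem stair_mem_chain (c : Fin (n + 1) → ℝ) (m : Fin (n + 1)) : stair c m ∈ chain c :=
  subset_convexHull ℝ _ ⟨m, rfl⟩

theorem chain_subset {c : Fin (n + 1) → ℝ} {K : Set (Fin (n + 1) → ℝ)} (hK : Convex ℝ K)
    (h : ∀ m, stair c m ∈ K) : chain c ⊆ K :=
  convexHull_min (by rintro _ ⟨m, rfl⟩; exact h m) hK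

theorem convex_chain (c : Fin (n + 1) → ℝ) : Convex ℝ (chain c) := convex_convexHull ℝ _

theorem chain_zero {c s : Fin (n + 1) → ℝ} (hs : s ∈ chain c) : s 0 = c 0 := by
  refine chain_subset (K := {s | s 0 = c 0}) ?_ (fun m => ?_) hs
  · rintro x hx y hy α β _ _ hαβ
    simp only [Set.mem_ofPred_eq, Pi.add_apply, Pi.smul_apply, smul_eq_mul] at *
    rw [hx, hy, ← add_mul, hαβ, one_mul]
  · simp [stair]

theorem stair_monotone {c : Fin (n + 1) → ℝ} (hc : Monotone c) (m : Fin (n + 1)) :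
    Monotone (stair c m) := fun _ _ h => hc (min_le_min le_rfl h)

theorem chain_monotone {c s : Fin (n + 1) → ℝ} (hc : Monotone c) (hs : s ∈ chain c) :
    Monotone s := by
  refine chain_subset (K := {s | Monotone s}) ?_ (stair_monotone hc) hs
  rintro x hx y hy α β hα hβ _ i j h
  simp only [Pi.add_apply, Pi.smul_apply, smul_eq_mul]
  exact add_le_add (mul_le_mul_of_nonneg_left (hx h) hα) (mul_le_mul_of_nonneg_left (hy h) hβ)

theorem chain_le {c s : Fin (n + 1) → ℝ} (hc : Monotone c) (hs : s ∈ chain c)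
    (j : Fin (n + 1)) : s j ≤ c j := by
  refine chain_subset (K := Set.Iic c) (convex_Iic c) (fun m j => hc (min_le_right _ _)) hs j

/-- The points of a chain are restrictions of concave functions. -/
theorem chain_exists_concaveOn {c s : Fin (n + 1) → ℝ} (hc : Monotone c) (hs : s ∈ chain c) :
    ∃ S : ℝ → ℝ, ConcaveOn ℝ Set.univ S ∧ ∀ j, s j = S (c j) := by
  refine chain_subset (K := {s | ∃ S : ℝ → ℝ, ConcaveOn ℝ Set.univ S ∧ ∀ j, s j = S (c j)})
    ?_ (fun m => ?_) hs
  · rintro x ⟨S, hS, hx⟩ y ⟨S', hS', hy⟩ α β hα hβ _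
    refine ⟨α • S + β • S', (hS.smul hα).add (hS'.smul hβ), fun j => ?_⟩
    simp [hx, hy]
  · refine ⟨fun p => min (c m) p, ?_, fun j => ?_⟩
    · exact (concaveOn_const (c m) convex_univ).inf (concaveOn_id convex_univ)
    · exact hc.map_min

/-- The sequence `s` is a restriction of a concave function to the points `c`, expressed by
inequalities. -/
def ConcaveAlong (c s : Fin (n + 1) → ℝ) : Prop :=
  (∀ i j, c i = c j → s i = s j) ∧
    ∀ i j k, i ≤ j → j ≤ k → (c k - c j) * s i + (c j - c i) * s k ≤ (c k - c i) * s j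

theorem chain_concaveAlong {c s : Fin (n + 1) → ℝ} (hc : Monotone c) (hs : s ∈ chain c) :
    ConcaveAlong c s := by
  obtain ⟨S, hS, h⟩ := chain_exists_concaveOn hc hs
  refine ⟨fun i j hij => by rw [h, h, hij], fun i j k hij hjk => ?_⟩
  have h1 := hc hij
  have h2 := hc hjk
  rcases eq_or_lt_of_le (h1.trans h2) with h3 | h3
  · have e1 : c i = c j := le_antisymm h1 (h3 ▸ h2)
    rw [← h3, ← e1]; simp
  · have hd : 0 < c k - c i := sub_pos.2 h3
    have := hS.2 (Set.mem_univ (c i)) (Set.mem_univ (c k))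
      (div_nonneg (by linarith) hd.le : 0 ≤ (c k - c j) / (c k - c i))
      (div_nonneg (by linarith) hd.le : 0 ≤ (c j - c i) / (c k - c i)) (by field_simp; ring)
    have e : ((c k - c j) / (c k - c i)) • c i + ((c j - c i) / (c k - c i)) • c k = c j := by
      simp only [smul_eq_mul]; field_simp; ring
    rw [e, ← h, ← h, ← h] at this
    simp only [smul_eq_mul] at this
    calc (c k - c j) * s i + (c j - c i) * s k
        = (c k - c i) * ((c k - c j) / (c k - c i) * s i + (c j - c i) / (c k - c i) * s k) := by
          field_simp
      _ ≤ _ := mul_le_mul_of_nonneg_left this hd.le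

/-- Cutting the points `c` off at a level `g` in their range gives a point of the chain. -/
theorem clip_mem_chain {c : Fin (n + 1) → ℝ} (hc : Monotone c) {g : ℝ} (h0 : c 0 ≤ g)
    (hg : g ≤ c (Fin.last n)) : (fun j => min (c j) g) ∈ chain c := by
  -- Induction locates consecutive nodes around `g`; the clipped sequence is the mixture of their
  -- two vertices with mean `g`.
  have key : ∀ k : Fin (n + 1), g ≤ c k → (fun j => min (c j) g) ∈ chain c := by
    intro k
    induction k using Fin.induction with
    | zero =>
      intro h
      have e : g = c 0 := le_antisymm h h0
      convert stair_mem_chain c 0 using 1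
      funext j
      simp [stair, e, hc (Fin.zero_le j)]
    | succ k ih =>
      intro h
      rcases le_or_gt g (c k.castSucc) with h1 | h1
      · exact ih h1
      have hd : 0 < c k.succ - c k.castSucc := by linarith
      have := convex_chain c (stair_mem_chain c k.castSucc) (stair_mem_chain c k.succ)
        (a := (c k.succ - g) / (c k.succ - c k.castSucc))
        (b := (g - c k.castSucc) / (c k.succ - c k.castSucc))
        (div_nonneg (by linarith) hd.le) (div_nonneg (by linarith) hd.le) (by field_simp; ring)
      convert this using 1
      funext j
      simp only [Pi.add_apply, Pi.smul_apply, smul_eq_mul, stair]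
      rcases le_or_gt j k.castSucc with hj | hj
      · have h2 : j ≤ k.succ := hj.trans (Fin.castSucc_lt_succ).le
        have h3 := hc hj
        rw [min_eq_right hj, min_eq_right h2, min_eq_left (by linarith)]
        field_simp; ring
      · have h2 : k.succ ≤ j := Fin.castSucc_lt_iff_succ_le.1 hj
        have h3 := hc h2
        rw [min_eq_left hj.le, min_eq_left h2, min_eq_right (by linarith)]
        field_simp; ring
  exact key _ hg

/-- Linear maps of the chain to itself that preserve the last coordinate. In terms of random
variables `ξ` with `s_j = E min(ξ, c_j)`, these are the transitions of martingales. -/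
def IsSpread (c : Fin (n + 1) → ℝ) (T : (Fin (n + 1) → ℝ) →ₗ[ℝ] (Fin (n + 1) → ℝ)) : Prop :=
  ∀ q ∈ chain c, T q ∈ chain c ∧ T q (Fin.last n) = q (Fin.last n)

theorem IsSpread.comp {c : Fin (n + 1) → ℝ} {T T' : (Fin (n + 1) → ℝ) →ₗ[ℝ] (Fin (n + 1) → ℝ)}
    (h : IsSpread c T) (h' : IsSpread c T') : IsSpread c (T ∘ₗ T') := fun q hq =>
  ⟨(h _ (h' q hq).1).1, (h _ (h' q hq).1).2.trans (h' q hq).2⟩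

theorem IsSpread.mix {c : Fin (n + 1) → ℝ} {T T' : (Fin (n + 1) → ℝ) →ₗ[ℝ] (Fin (n + 1) → ℝ)}
    (h : IsSpread c T) (h' : IsSpread c T') {α β : ℝ} (hα : 0 ≤ α) (hβ : 0 ≤ β)
    (hαβ : α + β = 1) : IsSpread c (α • T + β • T') := fun q hq => by
  refine ⟨convex_chain c (h q hq).1 (h' q hq).1 hα hβ hαβ, ?_⟩
  simp only [LinearMap.add_apply, LinearMap.smul_apply, Pi.add_apply, Pi.smul_apply, smul_eq_mul,
    (h q hq).2, (h' q hq).2]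
  rw [← add_mul, hαβ, one_mul]

/-- Replace the entries between `i` and `k` by linear interpolation. -/
noncomputable def chord (c : Fin (n + 1) → ℝ) (i k : Fin (n + 1)) :
    (Fin (n + 1) → ℝ) →ₗ[ℝ] (Fin (n + 1) → ℝ) where
  toFun q j := if i < j ∧ j < k then q i + (c j - c i) / (c k - c i) * (q k - q i) else q j
  map_add' x y := by
    funext j
    simp only [Pi.add_apply]
    split_ifs
    · ring
    · rfl
  map_smul' r x := by
    funext j
    simp only [Pi.smul_apply, smul_eq_mul, RingHom.id_apply]
    split_ifs
    · ring
    · rfl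

theorem chord_apply (c : Fin (n + 1) → ℝ) (i k : Fin (n + 1)) (q : Fin (n + 1) → ℝ)
    (j : Fin (n + 1)) : chord c i k q j =
      if i < j ∧ j < k then q i + (c j - c i) / (c k - c i) * (q k - q i) else q j := rfl

/-- In terms of `ξ`, mass at a node strictly between `i` and `k` moves to the two ends with its mean
preserved. The other vertices are already affine between `c i` and `c k`, hence fixed. -/
theorem isSpread_chord {c : Fin (n + 1) → ℝ} (hc : Monotone c) {i k : Fin (n + 1)}
    (hik : c i < c k) : IsSpread c (chord c i k) := by
  have hd : 0 < c k - c i := sub_pos.2 hik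
  have hik' : i < k := lt_of_not_ge fun h => not_lt.2 (hc h) hik
  have last : ∀ q, chord c i k q (Fin.last n) = q (Fin.last n) := fun q => by
    rw [chord_apply, if_neg]
    exact fun h => absurd h.2 (not_lt.2 (Fin.le_last k))
  have vert : ∀ m, chord c i k (stair c m) ∈ chain c := by
    intro m
    rcases le_or_gt m i with hm | hm
    · convert stair_mem_chain c m using 1
      funext j
      rw [chord_apply]
      split_ifs with h
      · simp only [stair, min_eq_left hm, min_eq_left (hm.trans hik'.le),
          min_eq_left (hm.trans h.1.le)]
        ring
      · rfl
    rcases le_or_gt k m with hm' | hm'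
    · convert stair_mem_chain c m using 1
      funext j
      rw [chord_apply]
      split_ifs with h
      · simp only [stair, min_eq_right hm.le, min_eq_right hm', min_eq_right (h.2.le.trans hm')]
        field_simp; ring
      · rfl
    have h1 := hc hm.le
    have h2 := hc hm'.le
    have := convex_chain c (stair_mem_chain c i) (stair_mem_chain c k)
      (a := (c k - c m) / (c k - c i)) (b := (c m - c i) / (c k - c i))
      (div_nonneg (by linarith) hd.le) (div_nonneg (by linarith) hd.le) (by field_simp; ring)
    convert this using 1
    funext j
    rw [chord_apply]
    simp only [Pi.add_apply, Pi.smul_apply, smul_eq_mul, stair]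
    split_ifs with h
    · simp only [min_eq_right hm.le, min_eq_left hm'.le, min_eq_left h.1.le, min_eq_right h.2.le]
      field_simp; ring
    · rcases le_or_gt j i with hj | hj
      · simp only [min_eq_right hj, min_eq_right (hj.trans hm.le), min_eq_right (hj.trans hik'.le)]
        field_simp; ring
      · have hj' : k ≤ j := not_lt.1 fun h' => h ⟨hj, h'⟩
        simp only [min_eq_left hj.le, min_eq_left (hm'.le.trans hj'), min_eq_left hj']
        field_simp; ring
  intro q hq
  exact ⟨chain_subset ((convex_chain c).linear_preimage (chord c i k)) vert hq, last q⟩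

/-- A point of the chain can be transformed, by a linear map that respects the chain and the last
coordinate, to any smaller concave sequence with the same first and last entries. -/
theorem exists_isSpread {c s s' : Fin (n + 1) → ℝ} (hc : Monotone c) (hs : s ∈ chain c)
    (hs' : ConcaveAlong c s') (hle : s' ≤ s) (h0 : s' 0 = s 0)
    (hlast : s' (Fin.last n) = s (Fin.last n)) :
    ∃ T, IsSpread c T ∧ T s = s' := by
  -- The target is matched from left to right, by spreads that keep the image above `s'`.
  have key : ∀ i : Fin (n + 1), ∃ T, IsSpread c T ∧ s' ≤ T s ∧ ∀ j ≤ i, T s j = s' j := by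
    intro i
    induction i using Fin.induction with
    | zero =>
      refine ⟨LinearMap.id, fun q hq => ⟨hq, rfl⟩, hle, fun j hj => ?_⟩
      rw [Fin.le_zero_iff.1 hj]; exact h0.symm
    | succ i ih =>
      obtain ⟨T, hT, hTle, hTeq⟩ := ih
      set r := T s with hr
      have hrl : r (Fin.last n) = s (Fin.last n) := (hT s hs).2
      have hrc : ConcaveAlong c r := chain_concaveAlong hc (hT s hs).1
      rcases eq_or_lt_of_le (hTle i.succ) with heq | hlt
      · refine ⟨T, hT, hTle, fun j hj => ?_⟩
        rcases eq_or_lt_of_le hj with rfl | hj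
        · exact heq.symm
        · exact hTeq j (Fin.le_castSucc_iff.2 hj)
      have hri : r i.castSucc = s' i.castSucc := hTeq _ le_rfl
      -- At coinciding nodes both sequences repeat their value, so they could not first differ here.
      have hci : c i.castSucc < c i.succ := by
        refine lt_of_le_of_ne (hc (Fin.castSucc_lt_succ).le) fun h => ?_
        rw [← hs'.1 _ _ h, ← hrc.1 _ _ h, hri] at hlt
        exact lt_irrefl _ hlt
      set σ := (s' i.succ - s' i.castSucc) / (c i.succ - c i.castSucc) with hσ
      have hd : 0 < c i.succ - c i.castSucc := sub_pos.2 hci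
      have line : ∀ j, i.succ ≤ j → s' j ≤ s' i.castSucc + (c j - c i.castSucc) * σ := by
        intro j hj
        have h1 := hs'.2 _ _ _ (Fin.castSucc_lt_succ).le hj
        rw [hσ, ← sub_le_iff_le_add', mul_div_assoc', le_div_iff₀ hd]
        nlinarith
      have line' : s' i.succ = s' i.castSucc + (c i.succ - c i.castSucc) * σ := by
        rw [hσ]; field_simp; ring
      -- Extend the segment of `s'` over `[c_i, c_{i+1}]` to a line of slope `σ`. By concavity `s'`
      -- stays below it, and `r` meets `s'` at the last index, so there is a first index `k` beyond
      -- `i+1` where `r` is no longer above the line.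
      obtain ⟨k, ⟨hk1, hk2⟩, hkmin⟩ : ∃ k, (i.succ < k ∧
          r k ≤ s' i.castSucc + (c k - c i.castSucc) * σ) ∧ ∀ j < k, ¬ (i.succ < j ∧
          r j ≤ s' i.castSucc + (c j - c i.castSucc) * σ) := by
        have hne : ∃ k, i.succ < k ∧ r k ≤ s' i.castSucc + (c k - c i.castSucc) * σ := by
          refine ⟨Fin.last n, lt_of_le_of_ne (Fin.le_last _) fun h => ?_, ?_⟩
          · rw [h, hrl, hlast] at hlt
            exact lt_irrefl _ hlt
          · rw [hrl, ← hlast]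
            exact line _ (Fin.le_last _)
        obtain ⟨k, hk, hm⟩ := WellFounded.has_min (wellFounded_lt (α := Fin (n + 1)))
          {k | i.succ < k ∧ r k ≤ s' i.castSucc + (c k - c i.castSucc) * σ} hne
        exact ⟨k, hk, fun j hj h => hm j h hj⟩
      obtain ⟨p, rfl⟩ : ∃ p : Fin n, p.succ = k :=
        Fin.exists_succ_eq.2 (ne_of_gt ((Fin.zero_le _).trans_lt hk1))
      have hp1 : i.succ ≤ p.castSucc := Fin.le_castSucc_iff.2 hk1
      have hp2 : s' i.castSucc + (c p.castSucc - c i.castSucc) * σ < r p.castSucc := by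
        rcases eq_or_lt_of_le hp1 with h | h
        · rw [← h, ← line']; exact hlt
        · by_contra hcon
          exact hkmin _ (Fin.castSucc_lt_succ) ⟨h, not_lt.1 hcon⟩
      have hcp : c i.castSucc < c p.castSucc := hci.trans_le (hc hp1)
      have hck : c i.castSucc < c p.succ := hci.trans_le (hc hk1.le)
      -- With `p = k - 1`, the chords of `r` from `i` to `p` and from `i` to `k` have slopes `A > σ
      -- ≥ B`. A mixture of the two chord maps therefore follows the line between `i` and `k`.
      set A := (r p.castSucc - r i.castSucc) / (c p.castSucc - c i.castSucc) with hA
      set B := (r p.succ - r i.castSucc) / (c p.succ - c i.castSucc) with hB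
      have hA' : σ < A := by
        rw [hA, lt_div_iff₀ (sub_pos.2 hcp), hri]; linarith
      have hB' : B ≤ σ := by
        rw [hB, div_le_iff₀ (sub_pos.2 hck), hri]; linarith
      have hAB : 0 < A - B := by linarith
      set α := (A - σ) / (A - B) with hα
      set β := (σ - B) / (A - B) with hβ
      have hαβ : α + β = 1 := by rw [hα, hβ]; field_simp; ring
      have hmix : α * B + β * A = σ := by rw [hα, hβ]; field_simp; ring
      have hU := (isSpread_chord hc hck).mix (isSpread_chord hc hcp)
        (div_nonneg (by linarith) hAB.le : 0 ≤ α) (div_nonneg (by linarith) hAB.le : 0 ≤ β) hαβ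
      set U := α • chord c i.castSucc p.succ + β • chord c i.castSucc p.castSucc with hUdef
      have hUr : ∀ j, U r j = if i.castSucc < j ∧ j < p.succ then
          s' i.castSucc + (c j - c i.castSucc) * σ else r j := by
        intro j
        simp only [hUdef, LinearMap.add_apply, LinearMap.smul_apply, Pi.add_apply, Pi.smul_apply,
          smul_eq_mul, chord_apply]
        have e1 : ∀ x, (c j - c i.castSucc) / (c x - c i.castSucc) * (r x - r i.castSucc)
            = (c j - c i.castSucc) * ((r x - r i.castSucc) / (c x - c i.castSucc)) :=
          fun x => by ring
        have e2 : ∀ x, α * x + β * x = x := fun x => by rw [← add_mul, hαβ, one_mul]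
        by_cases h : i.castSucc < j ∧ j < p.succ
        · rw [if_pos h, if_pos h, e1, ← hB, ← hri, ← hmix]
          -- The shorter chord map leaves the entry at `p` itself alone, but `r` lies on that chord
          -- there.
          have e3 : (if i.castSucc < j ∧ j < p.castSucc then r i.castSucc +
              (c j - c i.castSucc) / (c p.castSucc - c i.castSucc) *
              (r p.castSucc - r i.castSucc) else r j)
              = r i.castSucc + (c j - c i.castSucc) * A := by
            split_ifs with h'
            · rw [e1]
            · have : j = p.castSucc := by
                refine le_antisymm (Fin.le_castSucc_iff.2 h.2) (not_lt.1 fun h'' => h' ⟨h.1, h''⟩)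
              subst this
              rw [hA, mul_div_cancel₀ _ (sub_pos.2 hcp).ne']; ring
          rw [e3]
          calc _ = (α * r i.castSucc + β * r i.castSucc) +
              (c j - c i.castSucc) * (α * B + β * A) := by ring
            _ = _ := by rw [e2]
        · rw [if_neg h, if_neg h, if_neg, e2]
          exact fun h' => h ⟨h'.1, h'.2.trans (Fin.castSucc_lt_succ)⟩
      refine ⟨U ∘ₗ T, hU.comp hT, fun j => ?_, fun j hj => ?_⟩
      · rw [LinearMap.comp_apply, ← hr, hUr]
        split_ifs with h
        · exact line j (Fin.castSucc_lt_iff_succ_le.1 h.1)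
        · exact hTle j
      · rw [LinearMap.comp_apply, ← hr, hUr]
        split_ifs with h
        · have : j = i.succ := le_antisymm hj (Fin.castSucc_lt_iff_succ_le.1 h.1)
          rw [this, line']
        · refine hTeq j (not_lt.1 fun h' => h ⟨h', hj.trans_lt hk1⟩)
  obtain ⟨T, hT, -, h⟩ := key (Fin.last n)
  exact ⟨T, hT, funext fun j => h j (Fin.le_last j)⟩

end Chain

/-! ### The incremental parametrization of a chain and its affine section. -/

section Incremental

variable {n : ℕ}

theorem sum_telescope (h : Fin (n + 1) → ℝ) (j : Fin (n + 1)) :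
    (∑ q : Fin n, if q.succ ≤ j then h q.succ - h q.castSucc else 0) = h j - h 0 := by
  induction j using Fin.induction with
  | zero => simp
  | succ j ih =>
    have e : ∀ q : Fin n, (if q.succ ≤ j.succ then h q.succ - h q.castSucc else 0)
        = (if q.succ ≤ j.castSucc then h q.succ - h q.castSucc else 0)
          + if q = j then h q.succ - h q.castSucc else 0 := by
      intro q
      rcases lt_trichotomy q j with hq | rfl | hq
      · have h1 : q.succ ≤ j.castSucc := Fin.succ_le_castSucc_iff.2 hq
        rw [if_pos (Fin.succ_le_succ_iff.2 hq.le), if_pos h1, if_neg hq.ne, add_zero]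
      · rw [if_pos le_rfl, if_neg (not_le.2 (Fin.castSucc_lt_succ)), if_pos rfl, zero_add]
      · rw [if_neg (fun h => absurd (Fin.succ_le_succ_iff.1 h) (not_le.2 hq)),
          if_neg (fun h => absurd (Fin.succ_le_castSucc_iff.1 h) (not_lt.2 hq.le)),
          if_neg hq.ne', add_zero]
    rw [Finset.sum_congr rfl fun q _ => e q, Finset.sum_add_distrib, ih]
    simp

/-- The map `z ↦ (c_0 z_0 + ∑_{1 ≤ q ≤ j} (c_q - c_{q-1}) z_q)_j`. -/
def increment (c : Fin (n + 1) → ℝ) : (Fin (n + 1) → ℝ) →ₗ[ℝ] (Fin (n + 1) → ℝ) where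
  toFun z j := c 0 * z 0 + ∑ q : Fin n, if q.succ ≤ j then (c q.succ - c q.castSucc) * z q.succ
    else 0
  map_add' x y := by
    funext j
    have : ∀ q : Fin n,
      (if q.succ ≤ j then (c q.succ - c q.castSucc) * (x q.succ + y q.succ) else 0)
      = (if q.succ ≤ j then (c q.succ - c q.castSucc) * x q.succ else 0)
        + (if q.succ ≤ j then (c q.succ - c q.castSucc) * y q.succ else 0) := fun q => by
      split_ifs
      · ring
      · simp
    simp only [Pi.add_apply, this, Finset.sum_add_distrib]
    ring
  map_smul' r x := by
    funext j
    simp only [Pi.smul_apply, smul_eq_mul, RingHom.id_apply, mul_add, Finset.mul_sum, mul_ite,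
      mul_zero]
    congr 1
    · ring
    · refine Finset.sum_congr rfl fun q _ => ?_
      split_ifs
      · ring
      · rfl

theorem increment_apply (c z : Fin (n + 1) → ℝ) (j : Fin (n + 1)) :
    increment c z j = c 0 * z 0 + ∑ q : Fin n, if q.succ ≤ j then
      (c q.succ - c q.castSucc) * z q.succ else 0 := rfl

/-- The simplex of the vectors `1 = z_0 ≥ z_1 ≥ ⋯ ≥ z_n ≥ 0`. -/
def steps (n : ℕ) : Set (Fin (n + 1) → ℝ) := {z | z 0 = 1 ∧ Antitone z ∧ 0 ≤ z (Fin.last n)}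

/-- The vertices `(1, …, 1, 0, …, 0)` of the simplex `steps n`. -/
def step (m j : Fin (n + 1)) : ℝ := if j ≤ m then 1 else 0

theorem increment_step (c : Fin (n + 1) → ℝ) (m : Fin (n + 1)) :
    increment c (step m) = stair c m := by
  funext j
  rw [increment_apply]
  have : ∀ q : Fin n, (if q.succ ≤ j then (c q.succ - c q.castSucc) * step m q.succ else 0)
      = if q.succ ≤ min m j then c q.succ - c q.castSucc else 0 := by
    intro q
    simp only [step, le_min_iff]
    split_ifs <;> simp_all
  rw [Finset.sum_congr rfl fun q _ => this q, sum_telescope c]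
  simp [step, stair]

theorem step_mem_steps (m : Fin (n + 1)) : step m ∈ steps n := by
  refine ⟨by simp [step], fun i j hij => ?_, ?_⟩
  · simp only [step]
    split_ifs with h1 h2
    · exact le_rfl
    · exact absurd (hij.trans h1) h2
    · exact zero_le_one
    · exact le_rfl
  · simp only [step]; split_ifs <;> norm_num

theorem convex_steps (n : ℕ) : Convex ℝ (steps n) := by
  rintro x ⟨hx0, hx, hxn⟩ y ⟨hy0, hy, hyn⟩ α β hα hβ hαβ
  refine ⟨?_, fun i j hij => ?_, ?_⟩
  · simp [hx0, hy0, hαβ]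
  · simp only [Pi.add_apply, Pi.smul_apply, smul_eq_mul]
    exact add_le_add (mul_le_mul_of_nonneg_left (hx hij) hα) (mul_le_mul_of_nonneg_left (hy hij) hβ)
  · simp only [Pi.add_apply, Pi.smul_apply, smul_eq_mul]
    positivity

theorem steps_eq (n : ℕ) : steps n = convexHull ℝ (Set.range (step (n := n))) := by
  refine Set.Subset.antisymm ?_ (convexHull_min ?_ (convex_steps n))
  · rintro z ⟨h0, hz, hn⟩
    -- The weights of the vertices are the drops `z_m - z_{m+1}`; the appended `0` supplies the last
    -- drop `z_n`.
    set z' : Fin (n + 2) → ℝ := Fin.snoc (α := fun _ => ℝ) z 0 with hz'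
    have hcs : ∀ j : Fin (n + 1), z' j.castSucc = z j := fun j => Fin.snoc_castSucc ..
    have hlast : z' (Fin.last (n + 1)) = 0 := Fin.snoc_last ..
    have hpos : ∀ m : Fin (n + 1), 0 ≤ z' m.castSucc - z' m.succ := by
      intro m
      rw [hcs]
      rcases Fin.eq_castSucc_or_eq_last m.succ with ⟨k, hk⟩ | hk
      · rw [hk, hcs]
        refine sub_nonneg.2 (hz ?_)
        have := congrArg Fin.val hk
        rw [Fin.le_def]; simp at this; omega
      · rw [hk, hlast, sub_zero]
        exact hn.trans (hz (Fin.le_last m))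
    have tel : ∀ j : Fin (n + 1),
        (∑ m : Fin (n + 1), if j ≤ m then z' m.castSucc - z' m.succ else 0) = z j := by
      intro j
      have h1 := sum_telescope z' j.castSucc
      have h2 := sum_telescope z' (Fin.last (n + 1))
      simp only [Fin.le_last, if_true] at h1 h2
      have h3 : ∀ m : Fin (n + 1), (if j ≤ m then z' m.castSucc - z' m.succ else 0)
          = (if m.succ ≤ j.castSucc then z' m.succ - z' m.castSucc else 0)
            - (z' m.succ - z' m.castSucc) := by
        intro m
        rcases le_or_gt j m with h | h
        · rw [if_pos h, if_neg (fun h' => absurd (Fin.succ_le_castSucc_iff.1 h') (not_lt.2 h))]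
          ring
        · rw [if_neg (not_le.2 h), if_pos (Fin.succ_le_castSucc_iff.2 h)]; ring
      rw [Finset.sum_congr rfl fun m _ => h3 m, Finset.sum_sub_distrib, h1, h2, hlast, hcs]
      ring
    have hsum : ∑ m : Fin (n + 1), (z' m.castSucc - z' m.succ) = 1 := by
      rw [← h0, ← tel 0]; simp
    have := (convex_convexHull ℝ (Set.range (step (n := n)))).sum_mem (t := Finset.univ)
      (fun m _ => hpos m) hsum (fun m _ => subset_convexHull ℝ _ ⟨m, rfl⟩)
    convert this using 1
    funext j
    rw [Finset.sum_apply, ← tel j]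
    refine Finset.sum_congr rfl fun m _ => ?_
    simp [step]
  · rintro _ ⟨m, rfl⟩
    exact step_mem_steps m

theorem steps_subset {K : Set (Fin (n + 1) → ℝ)} (hK : Convex ℝ K) (h : ∀ m, step m ∈ K) :
    steps n ⊆ K := by
  rw [steps_eq]
  exact convexHull_min (by rintro _ ⟨m, rfl⟩; exact h m) hK

theorem increment_mem_chain (c : Fin (n + 1) → ℝ) {z : Fin (n + 1) → ℝ} (hz : z ∈ steps n) :
    increment c z ∈ chain c := by
  refine steps_subset ((convex_chain c).linear_preimage (increment c)) (fun m => ?_) hz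
  rw [Set.mem_preimage, increment_step]
  exact stair_mem_chain c m

/-- The first index at which the value `c j` is taken. -/
noncomputable def firstIndex (c : Fin (n + 1) → ℝ) (j : Fin (n + 1)) : Fin (n + 1) :=
  open Classical in (Finset.univ.filter fun k => c k = c j).min' ⟨j, by simp⟩

theorem apply_firstIndex (c : Fin (n + 1) → ℝ) (j : Fin (n + 1)) : c (firstIndex c j) = c j := by
  classical
  have := Finset.min'_mem (Finset.univ.filter fun k => c k = c j) ⟨j, by simp⟩
  exact (Finset.mem_filter.1 this).2

theorem firstIndex_le {c : Fin (n + 1) → ℝ} {j k : Fin (n + 1)} (h : c k = c j) :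
    firstIndex c j ≤ k := by
  classical
  exact Finset.min'_le _ _ (by simp [h])

theorem firstIndex_mono {c : Fin (n + 1) → ℝ} (hc : Monotone c) : Monotone (firstIndex c) := by
  intro i j hij
  by_contra! h
  have h1 := hc h.le
  rw [apply_firstIndex c, apply_firstIndex c] at h1
  have h2 : c (firstIndex c j) = c i := by rw [apply_firstIndex c]; exact le_antisymm h1 (hc hij)
  exact absurd (firstIndex_le h2) (not_le.2 h)

/-- A section of `increment c`; the slope at `j` is that on the left of the first point that
equals `c j`. -/
noncomputable def slopes (c s : Fin (n + 1) → ℝ) (j : Fin (n + 1)) : ℝ :=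
  Fin.cases 1 (fun q => (s q.succ - s q.castSucc) / (c q.succ - c q.castSucc)) (firstIndex c j)

theorem slopes_preservesMix (c : Fin (n + 1) → ℝ) : PreservesMix (slopes c) := by
  intro x y α β h
  funext j
  simp only [slopes, Pi.add_apply, Pi.smul_apply, smul_eq_mul]
  generalize firstIndex c j = e
  cases e using Fin.cases with
  | zero => simp [h]
  | succ q => simp only [Fin.cases_succ]; ring

theorem lt_of_firstIndex_eq_succ {c : Fin (n + 1) → ℝ} (hc : Monotone c) {j : Fin (n + 1)}
    {q : Fin n} (h : firstIndex c j = q.succ) : c q.castSucc < c q.succ := by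
  refine lt_of_le_of_ne (hc (Fin.castSucc_lt_succ).le) fun h' => ?_
  have h1 : c q.castSucc = c j := by rw [h', ← h, apply_firstIndex c]
  have := firstIndex_le h1
  rw [h] at this
  exact absurd this (not_le.2 (Fin.castSucc_lt_succ))

theorem slopes_stair {c : Fin (n + 1) → ℝ} (hc : Monotone c) (m j : Fin (n + 1)) :
    slopes c (stair c m) j = step m (firstIndex c j) := by
  unfold slopes
  cases he : firstIndex c j using Fin.cases with
  | zero => simp [step]
  | succ q =>
    have hlt := lt_of_firstIndex_eq_succ hc he
    simp only [Fin.cases_succ, stair, step]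
    split_ifs with h
    · rw [min_eq_right h, min_eq_right ((Fin.castSucc_lt_succ).le.trans h),
        div_self (sub_pos.2 hlt).ne']
    · have h1 : m < q.succ := not_le.1 h
      rw [min_eq_left h1.le, min_eq_left (Fin.le_castSucc_iff.2 h1), sub_self, zero_div]

/-- On a vertex the slopes are a step composed with the monotone `firstIndex`, hence antitone.
Difference quotients taken at a repeated node itself would be `0 / 0 = 0` and could break this. -/
theorem slopes_mem_steps {c s : Fin (n + 1) → ℝ} (hc : Monotone c) (hs : s ∈ chain c) :
    slopes c s ∈ steps n := by
  refine chain_subset (K := {s | slopes c s ∈ steps n}) ?_ (fun m => ?_) hs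
  · intro x hx y hy α β hα hβ hαβ
    rw [Set.mem_ofPred_eq, slopes_preservesMix c x y α β hαβ]
    exact convex_steps n hx hy hα hβ hαβ
  · have e : slopes c (stair c m) = fun j => step m (firstIndex c j) :=
      funext (slopes_stair hc m)
    rw [Set.mem_ofPred_eq, e]
    obtain ⟨h0, h1, h2⟩ := step_mem_steps m
    refine ⟨?_, h1.comp_monotone (firstIndex_mono hc), h2.trans (h1 (Fin.le_last _))⟩
    have : firstIndex c 0 = 0 := le_antisymm (firstIndex_le rfl) (Fin.zero_le _)
    simp only [this, h0]

theorem mul_slopes {c s : Fin (n + 1) → ℝ} (hc : Monotone c) (hs : s ∈ chain c) (q : Fin n) :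
    (c q.succ - c q.castSucc) * slopes c s q.succ = s q.succ - s q.castSucc := by
  rcases eq_or_lt_of_le (hc (Fin.castSucc_lt_succ (i := q)).le) with h | h
  · rw [h, (chain_concaveAlong hc hs).1 _ _ h]; ring
  · have he : firstIndex c q.succ = q.succ := by
      refine le_antisymm (firstIndex_le rfl) (not_lt.1 fun h' => ?_)
      have := hc (Fin.le_castSucc_iff.2 h')
      rw [apply_firstIndex c] at this
      linarith
    rw [slopes, he, Fin.cases_succ, mul_div_cancel₀ _ (sub_pos.2 h).ne']

/-- The slopes, adjusted to be `1` up to `p` and `0` beyond `p'`. -/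
noncomputable def slopesOn (c : Fin (n + 1) → ℝ) (p p' : Fin (n + 1)) (s : Fin (n + 1) → ℝ)
    (j : Fin (n + 1)) : ℝ := if j ≤ p then 1 else if p' < j then 0 else slopes c s j

theorem slopesOn_preservesMix (c : Fin (n + 1) → ℝ) (p p' : Fin (n + 1)) :
    PreservesMix (slopesOn c p p') := by
  intro x y α β h
  funext j
  simp only [slopesOn, slopes_preservesMix c x y α β h, Pi.add_apply, Pi.smul_apply, smul_eq_mul]
  split_ifs <;> simp [h]

theorem mem_Icc_of_mem_steps {z : Fin (n + 1) → ℝ} (hz : z ∈ steps n) (j : Fin (n + 1)) :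
    0 ≤ z j ∧ z j ≤ 1 :=
  ⟨hz.2.2.trans (hz.2.1 (Fin.le_last j)), hz.1 ▸ hz.2.1 (Fin.zero_le j)⟩

theorem slopesOn_mem_steps {c s : Fin (n + 1) → ℝ} (hc : Monotone c) (hs : s ∈ chain c)
    {p p' : Fin (n + 1)} (hp : p ≤ p') : slopesOn c p p' s ∈ steps n := by
  have h := slopes_mem_steps hc hs
  have hI := mem_Icc_of_mem_steps h
  refine ⟨by simp [slopesOn], fun i j hij => ?_, ?_⟩
  · simp only [slopesOn]
    split_ifs with h1 h2 h3 h4 h5 h6 h7 <;>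
      first
      | exact le_rfl
      | exact zero_le_one
      | exact (hI _).1
      | exact (hI _).2
      | exact h.2.1 hij
      | exact absurd h1 (by order)
  · simp only [slopesOn]
    split_ifs
    exacts [zero_le_one, le_rfl, (hI _).1]

/-- On the face of the chain that belongs to the piece from `p` to `p'`, the adjusted slopes are
inverse to `increment c`. -/
theorem increment_slopesOn {c s : Fin (n + 1) → ℝ} (hc : Monotone c) (hs : s ∈ chain c)
    {p p' : Fin (n + 1)} (h1 : ∀ j ≤ p, s j = c j) (h2 : s p' = s (Fin.last n)) :
    increment c (slopesOn c p p' s) = s := by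
  have hm := chain_monotone hc hs
  have hconst : ∀ j, p' ≤ j → s j = s (Fin.last n) := fun j hj =>
    le_antisymm (hm (Fin.le_last j)) (h2 ▸ hm hj)
  funext j
  rw [increment_apply]
  have : ∀ q : Fin n, (c q.succ - c q.castSucc) * slopesOn c p p' s q.succ
      = s q.succ - s q.castSucc := by
    intro q
    unfold slopesOn
    split_ifs with h h'
    · rw [h1 _ h, h1 _ ((Fin.castSucc_lt_succ).le.trans h), mul_one]
    · rw [hconst _ h'.le, hconst _ (Fin.le_castSucc_iff.2 h')]; ring
    · exact mul_slopes hc hs q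
  simp only [this]
  rw [sum_telescope s]
  simp [slopesOn, chain_zero hs]

end Incremental

/-! ### The local bounds of a box. -/

namespace DiscretizationScheme

variable {m d n : ℕ} {D : DiscretizationScheme d n}

/-- The local bounds on the box `t`. -/
def boxBound (D : DiscretizationScheme d n) (b : D.Coeff) (t : D.BoxIndex) :
    Fin d → Fin (n + 1) → ℝ := fun i j => D.boundOn b i j (t i)

theorem localBound_boxDelta (b : D.Coeff) (t : D.BoxIndex) :
    D.localBound b (D.boxDelta t) = D.boxBound b t := by
  funext i j
  simp only [localBound, boxBound, boundOn, boxDelta, mul_ite, mul_one, mul_zero]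
  rw [← Finset.sum_filter]
  congr 2
  ext k
  simp

theorem left_lt_right (i : Fin d) (t : Fin (D.l i)) : D.τ i t.castSucc < D.τ i t.succ :=
  D.τ_strictMono i (Fin.castSucc_lt_succ)

section Bounds

variable {X : Set (Fin m → ℝ)} {f : (Fin m → ℝ) → Fin d → ℝ}
  {u : Fin d → Fin (n + 1) → (Fin m → ℝ) → ℝ} {b : D.Coeff}

theorem IsAdmissible.boxBound_monotone (hb : D.IsAdmissible X f u b) (t : D.BoxIndex)
    (i : Fin d) : Monotone (D.boxBound b t i) := fun j' j h => by
  simp only [boxBound, boundOn]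
  exact add_le_add le_rfl (hb.mono i (t i) j' j h)

theorem IsAdmissible.boxBound_zero (hb : D.IsAdmissible X f u b) (t : D.BoxIndex) (i : Fin d) :
    D.boxBound b t i 0 = D.a i (D.τ i (t i).castSucc) := by
  have h := sum_telescope (fun k => D.a i (D.τ i k)) (t i).castSucc
  have e : ∑ k ∈ Finset.Iic (t i).castSucc, b i 0 k
      = ∑ k, if k ≤ (t i).castSucc then b i 0 k else 0 := by
    rw [← Finset.sum_filter]; congr 1; ext; simp
  simp only [boxBound, boundOn]
  rw [e, Fin.sum_univ_succ, hb.first_zero]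
  simp only [hb.first_succ, h, D.τ_zero]
  simp

theorem IsAdmissible.boxBound_last (hb : D.IsAdmissible X f u b) (t : D.BoxIndex) (i : Fin d) :
    D.boxBound b t i (Fin.last n) = D.a i (D.τ i (t i).succ) := by
  have h := sum_telescope (fun k => D.a i (D.τ i k)) (t i).succ
  have e : ∑ k ∈ Finset.Iic (t i).castSucc, b i (Fin.last n) k
      = ∑ k, if k ≤ (t i).castSucc then b i (Fin.last n) k else 0 := by
    rw [← Finset.sum_filter]; congr 1; ext; simp
  simp only [boxBound, boundOn]
  rw [e, Fin.sum_univ_castSucc, if_neg (not_le.2 (Fin.castSucc_lt_last _))]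
  simp only [Fin.succ_le_succ_iff] at h
  simp only [hb.last, Fin.castSucc_le_castSucc_iff, h, D.τ_zero]
  ring

/-- Condition `le_global` caps these bounds by the left end of the interval, which is already the
bound at index `0`. Repeated nodes are thus unavoidable for a box that does not start at the first
breakpoint. -/
theorem IsAdmissible.boxBound_of_le (hb : D.IsAdmissible X f u b) (t : D.BoxIndex) (i : Fin d)
    {j : Fin (n + 1)} (hj : j ≤ D.τ i (t i).castSucc) :
    D.boxBound b t i j = D.boxBound b t i 0 := by
  refine le_antisymm ?_ (hb.boxBound_monotone t i (Fin.zero_le j))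
  rw [hb.boxBound_zero]
  exact (hb.le_global i (t i) j).trans (max_le ((D.a_strictMono i).monotone hj) le_rfl)

theorem IsAdmissible.boxBound_le (hb : D.IsAdmissible X f u b) (t : D.BoxIndex) (i : Fin d)
    {j : Fin (n + 1)} (hj : D.τ i (t i).castSucc ≤ j) : D.boxBound b t i j ≤ D.a i j :=
  (hb.le_global i (t i) j).trans (max_le le_rfl ((D.a_strictMono i).monotone hj))

theorem IsAdmissible.chain_eq_boxBound {t : D.BoxIndex} (hb : D.IsAdmissible X f u b) {i : Fin d}
    {s : Fin (n + 1) → ℝ} (hs : s ∈ chain (D.boxBound b t i)) {j : Fin (n + 1)}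
    (hj : j ≤ D.τ i (t i).castSucc) : s j = D.boxBound b t i j := by
  have hc := hb.boxBound_monotone t i
  refine le_antisymm (chain_le hc hs j) ?_
  rw [hb.boxBound_of_le t i hj, ← chain_zero hs]
  exact chain_monotone hc hs (Fin.zero_le j)

end Bounds

/-! ### The faces of `Δ̄` selected by binary vectors. -/

section DeltaBar

theorem steps_of_mem_deltaBar {z : D.ZVar} {δ : D.DVar} (h : (z, δ) ∈ D.deltaBar) (i : Fin d) :
    z i ∈ steps n := ⟨(h i).1, (h i).2.1, (h i).2.2.1⟩

theorem convex_deltaBar : Convex ℝ D.deltaBar := by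
  rintro ⟨z, δ⟩ hx ⟨z', δ'⟩ hy α β hα hβ hαβ i
  obtain ⟨h0, h1, h2⟩ := convex_steps n (steps_of_mem_deltaBar hx i) (steps_of_mem_deltaBar hy i)
    hα hβ hαβ
  refine ⟨h0, h1, h2, ?_, ?_, fun t ht ht' => ⟨?_, fun j hj => ?_⟩⟩
  · have e1 : δ i 0 = 1 := (hx i).2.2.2.1
    have e2 : δ' i 0 = 1 := (hy i).2.2.2.1
    simp [e1, e2, hαβ]
  · have e1 : δ i (Fin.last _) = 0 := (hx i).2.2.2.2.1
    have e2 : δ' i (Fin.last _) = 0 := (hy i).2.2.2.2.1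
    simp [e1, e2]
  · exact add_le_add (mul_le_mul_of_nonneg_left ((hx i).2.2.2.2.2 t ht ht').1 hα)
      (mul_le_mul_of_nonneg_left ((hy i).2.2.2.2.2 t ht ht').1 hβ)
  · exact add_le_add (mul_le_mul_of_nonneg_left (((hx i).2.2.2.2.2 t ht ht').2 j hj) hα)
      (mul_le_mul_of_nonneg_left (((hy i).2.2.2.2.2 t ht ht').2 j hj) hβ)

theorem exists_index_succ {i : Fin d} {k : Fin (D.l i + 1)} (hk : k ≠ Fin.last (D.l i)) :
    ∃ j : Fin (n + 1), (j : ℕ) = (D.τ i k : ℕ) + 1 := by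
  have h := D.τ_strictMono i (lt_of_le_of_ne (Fin.le_last k) hk)
  rw [D.τ_last, Fin.lt_def, Fin.val_last] at h
  exact ⟨⟨D.τ i k + 1, by omega⟩, rfl⟩

theorem mem_Icc_of_mem_deltaBar {z : D.ZVar} {δ : D.DVar} (h : (z, δ) ∈ D.deltaBar) (i : Fin d)
    (k : Fin (D.l i + 1)) : 0 ≤ δ i k ∧ δ i k ≤ 1 := by
  have hI := mem_Icc_of_mem_steps (steps_of_mem_deltaBar h i)
  obtain ⟨-, -, -, h0, hl, hk⟩ := h i
  dsimp only at h0 hl hk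
  by_cases h1 : k = 0
  · rw [h1, h0]; norm_num
  by_cases h2 : k = Fin.last _
  · rw [h2, hl]; norm_num
  obtain ⟨h3, h4⟩ := hk k h1 h2
  obtain ⟨j, hj⟩ := exists_index_succ h2
  exact ⟨(hI j).1.trans (h4 j hj), h3.trans (hI _).2⟩

/-- Away from the fixed ends, `δ_k ≥ z_{τ(k)+1} ≥ z_{τ(k+1)} ≥ δ_{k+1}`. -/
theorem antitone_of_mem_deltaBar {z : D.ZVar} {δ : D.DVar} (h : (z, δ) ∈ D.deltaBar) (i : Fin d) :
    Antitone (δ i) := by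
  refine Fin.antitone_iff_succ_le.2 fun k => ?_
  have hI := mem_Icc_of_mem_deltaBar h i
  obtain ⟨-, hz, -, h0, hl, hk⟩ := h i
  dsimp only at hz h0 hl hk
  by_cases h1 : k.castSucc = 0
  · rw [h1, h0]; exact (hI _).2
  by_cases h2 : k.succ = Fin.last _
  · rw [h2, hl]; exact (hI _).1
  have h3 : k.castSucc ≠ Fin.last _ := (Fin.castSucc_lt_last k).ne
  obtain ⟨j, hj⟩ := exists_index_succ h3
  refine ((hk _ (Fin.succ_ne_zero k) h2).1).trans (le_trans (hz ?_) ((hk _ h1 h3).2 j hj))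
  have := left_lt_right i k
  rw [Fin.lt_def] at this
  rw [Fin.le_def]; omega

/-- The binary points of `Δ̄` select a box. -/
theorem exists_eq_boxDelta {z : D.ZVar} {δ : D.DVar} (h : (z, δ) ∈ D.deltaBar)
    (hδ : D.IsBinary δ) : ∃ t : D.BoxIndex, δ = D.boxDelta t := by
  have : ∀ i, ∃ t : Fin (D.l i), ∀ k, δ i k = if k ≤ t.castSucc then 1 else 0 := by
    intro i
    have hanti := antitone_of_mem_deltaBar h i
    have h0 : δ i 0 = 1 := (h i).2.2.2.1
    have hl : δ i (Fin.last _) = 0 := (h i).2.2.2.2.1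
    -- The box index is the last position where `δ i` equals `1`.
    obtain ⟨k, hk, hmax⟩ := Set.Finite.exists_maximal (Set.toFinite {k | δ i k = 1}) ⟨0, h0⟩
    have hk' : k ≠ Fin.last _ := by
      rintro rfl
      rw [Set.mem_ofPred_eq, hl] at hk
      norm_num at hk
    obtain ⟨t, rfl⟩ := Fin.exists_castSucc_eq.2 hk'
    refine ⟨t, fun q => ?_⟩
    split_ifs with hq
    · refine le_antisymm (mem_Icc_of_mem_deltaBar h i q).2 ?_
      rw [← show δ i t.castSucc = 1 from hk]
      exact hanti hq
    · refine (hδ i q).resolve_right fun h1 => hq (hmax h1 (le_of_not_ge hq))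
  choose t ht using this
  exact ⟨t, funext fun i => funext fun k => ht i k⟩

theorem eq_one_of_mem_deltaBar {z : D.ZVar} {t : D.BoxIndex} (h : (z, D.boxDelta t) ∈ D.deltaBar)
    {i : Fin d} {j : Fin (n + 1)} (hj : j ≤ D.τ i (t i).castSucc) : z i j = 1 := by
  have hz := steps_of_mem_deltaBar h i
  refine le_antisymm (mem_Icc_of_mem_steps hz j).2 ?_
  by_cases h1 : (t i).castSucc = 0
  · rw [h1, D.τ_zero, Fin.le_zero_iff] at hj
    rw [hj, hz.1]
  · have := ((h i).2.2.2.2.2 _ h1 (Fin.castSucc_lt_last _).ne).1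
    simp only [boxDelta, le_refl, if_true] at this
    exact this.trans (hz.2.1 hj)

theorem eq_zero_of_mem_deltaBar {z : D.ZVar} {t : D.BoxIndex}
    (h : (z, D.boxDelta t) ∈ D.deltaBar) {i : Fin d} {j : Fin (n + 1)}
    (hj : D.τ i (t i).succ < j) : z i j = 0 := by
  have hz := steps_of_mem_deltaBar h i
  refine le_antisymm ?_ (mem_Icc_of_mem_steps hz j).1
  have h1 : (t i).succ ≠ Fin.last _ := fun h1 => by
    rw [h1, D.τ_last] at hj
    exact absurd hj (not_lt.2 (Fin.le_last j))
  obtain ⟨q, hq⟩ := exists_index_succ h1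
  have := ((h i).2.2.2.2.2 _ (Fin.succ_ne_zero _) h1).2 q hq
  simp only [boxDelta, if_neg (not_le.2 (Fin.castSucc_lt_succ (i := t i)))] at this
  refine le_trans (hz.2.1 ?_) this
  rw [Fin.lt_def] at hj
  rw [Fin.le_def]; omega

theorem mem_deltaBar_boxDelta {z : D.ZVar} {t : D.BoxIndex} (hz : ∀ i, z i ∈ steps n)
    (h1 : ∀ i j, j ≤ D.τ i (t i).castSucc → z i j = 1)
    (h0 : ∀ i j, D.τ i (t i).succ < j → z i j = 0) : (z, D.boxDelta t) ∈ D.deltaBar := by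
  intro i
  refine ⟨(hz i).1, (hz i).2.1, (hz i).2.2, by simp [boxDelta],
    by simp [boxDelta], fun k _ _ => ?_⟩
  have hI := mem_Icc_of_mem_steps (hz i)
  simp only [boxDelta]
  split_ifs with hk
  · exact ⟨(h1 i _ ((D.τ_strictMono i).monotone hk)).ge, fun j _ => (hI j).2⟩
  · refine ⟨(hI _).1, fun j hj => (h0 i j ?_).le⟩
    have := (D.τ_strictMono i).monotone (Fin.castSucc_lt_iff_succ_le.1 (not_le.1 hk))
    rw [Fin.le_def] at this
    rw [Fin.lt_def]; omega

theorem slopesOn_mem_deltaBar {c s : Fin d → Fin (n + 1) → ℝ} (hc : ∀ i, Monotone (c i))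
    (hs : ∀ i, s i ∈ chain (c i)) (t : D.BoxIndex) :
    (fun i => slopesOn (c i) (D.τ i (t i).castSucc) (D.τ i (t i).succ) (s i), D.boxDelta t)
      ∈ D.deltaBar := by
  refine mem_deltaBar_boxDelta
    (fun i => slopesOn_mem_steps (hc i) (hs i) (left_lt_right i (t i)).le)
    (fun i j hj => ?_) (fun i j hj => ?_)
  · simp [slopesOn, hj]
  · simp [slopesOn, hj, (left_lt_right i (t i)).trans hj]

/-- On the face of `Δ̄` that belongs to a box, `G` is the incremental map for the local bounds. -/
theorem G_boxDelta (b : D.Coeff) {z : D.ZVar} {t : D.BoxIndex}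
    (h : (z, D.boxDelta t) ∈ D.deltaBar) (i : Fin d) :
    D.G b (z, D.boxDelta t) i = increment (D.boxBound b t i) (z i) := by
  funext j
  have hsum : ∀ g : Fin (D.l i + 1) → ℝ, ∑ k ∈ Finset.Iic (t i).castSucc, g k
      = ∑ k, D.boxDelta t i k * g k := by
    intro g
    simp only [boxDelta, ite_mul, one_mul, zero_mul]
    rw [← Finset.sum_filter]; congr 1; ext; simp
  have htel : ∀ k, b i (min (D.τ i k) j) k = b i 0 k +
      ∑ q : Fin n, if q.succ ≤ j then
        (if q.succ ≤ D.τ i k then b i q.succ k - b i q.castSucc k else 0) else 0 := by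
    intro k
    have e : ∀ q : Fin n, (if q.succ ≤ j then
        (if q.succ ≤ D.τ i k then b i q.succ k - b i q.castSucc k else 0) else 0)
        = if q.succ ≤ min (D.τ i k) j then b i q.succ k - b i q.castSucc k else 0 := by
      intro q
      simp only [le_min_iff]
      split_ifs <;> simp_all
    rw [Finset.sum_congr rfl fun q _ => e q, sum_telescope (fun q => b i q k)]
    ring
  rw [increment_apply, (steps_of_mem_deltaBar h i).1, mul_one]
  simp only [G, boxBound, boundOn, hsum, htel, mul_add, Finset.sum_add_distrib, Finset.mul_sum]
  rw [Finset.sum_comm (s := (Finset.univ : Finset (Fin (D.l i + 1))))]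
  -- `G` linearizes the products `δ_k z_q`, exactly on this face: if `τ(k) ≥ q`, the product is
  -- replaced by `δ_k`, right because `δ_k = 1` forces `z_q = 1`; if `τ(k) < q`, it is replaced by
  -- `z_q`, right because `δ_k = 0` forces `z_q = 0`.
  have key : ∀ q : Fin n, (if q.succ ≤ j then ∑ k, z i q.succ *
        (if D.τ i k < q.succ then b i q.succ k - b i q.castSucc k else 0) else 0) +
      ∑ k, D.boxDelta t i k * (if q.succ ≤ j then
        (if q.succ ≤ D.τ i k then b i q.succ k - b i q.castSucc k else 0) else 0)
      = if q.succ ≤ j then (D.a i 0 + ∑ k, D.boxDelta t i k * b i q.succ k -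
        (D.a i 0 + ∑ k, D.boxDelta t i k * b i q.castSucc k)) * z i q.succ else 0 := by
    intro q
    split_ifs with hq
    · rw [add_sub_add_left_eq_sub, ← Finset.sum_sub_distrib, Finset.sum_mul,
        ← Finset.sum_add_distrib]
      refine Finset.sum_congr rfl fun k _ => ?_
      simp only [boxDelta]
      rcases le_or_gt k (t i).castSucc with hk | hk
      · rcases lt_or_ge (D.τ i k) q.succ with h1 | h1
        · rw [if_pos hk, if_pos h1, if_neg (not_le.2 h1)]; ring
        · rw [if_pos hk, if_neg (not_lt.2 h1), if_pos h1,
            eq_one_of_mem_deltaBar h (h1.trans ((D.τ_strictMono i).monotone hk))]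
          ring
      · rw [if_neg (not_le.2 hk)]
        split_ifs with h1 h2
        · exact absurd h1 (not_lt.2 h2)
        · have h3 := (D.τ_strictMono i).monotone (Fin.castSucc_lt_iff_succ_le.1 hk)
          rw [eq_zero_of_mem_deltaBar h (h3.trans_lt h1)]; ring
        all_goals ring
    · simp
  rw [← Finset.sum_congr rfl fun q _ => key q, Finset.sum_add_distrib]
  ring

theorem increment_right_eq_last {c : Fin (n + 1) → ℝ} {z : D.ZVar} {t : D.BoxIndex}
    (h : (z, D.boxDelta t) ∈ D.deltaBar) (i : Fin d) :
    increment c (z i) (D.τ i (t i).succ) = increment c (z i) (Fin.last n) := by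
  rw [increment_apply, increment_apply]
  congr 1
  refine Finset.sum_congr rfl fun q _ => ?_
  rw [if_pos (Fin.le_last _)]
  split_ifs with hq
  · rfl
  · rw [eq_zero_of_mem_deltaBar h (not_le.1 hq), mul_zero]

/-- The envelope over `Δ̄` at a point of a box, compared with the envelope over a simplotope. -/
theorem concOn_deltaBar_le (φ : (Fin d → ℝ) → ℝ) (b : D.Coeff) (t : D.BoxIndex)
    (c : Fin d → Fin (n + 1) → ℝ) {M : Fin d → (Fin (n + 1) → ℝ) →ₗ[ℝ] (Fin (n + 1) → ℝ)}
    (hM : ∀ z i, (z, D.boxDelta t) ∈ D.deltaBar → M i (z i) ∈ chain (c i) ∧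
      M i (z i) (Fin.last n) = increment (D.boxBound b t i) (z i) (Fin.last n)) (z : D.ZVar) :
    concOn D.deltaBar (fun p => liftLast φ (D.G b p)) (z, D.boxDelta t) ≤
      concOn (simplotope c) (liftLast φ) fun i => M i (z i) := by
  refine envelope_le_envelope fun r hr => ?_
  have hface := mem_convexHull_inter_face
    (C := {w : (D.ZVar × D.DVar) × ℝ | w.1 ∈ D.deltaBar})
    (F := {w : (D.ZVar × D.DVar) × ℝ | w.1.2 = D.boxDelta t})
    (fun x hx y hy α β hα hβ hαβ => convex_deltaBar hx hy hα hβ hαβ) (fun w hw => hw.1) ?_ hr rfl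
  · refine mem_convexHull_of_preservesMix
      (Λ := fun p : D.ZVar × D.DVar => fun i => M i (p.1 i)) ?_ ?_ hface
    · intro x y α β _
      funext i
      simp
    · rintro ⟨⟨z, δ⟩, r⟩ ⟨⟨h1, h2⟩, h3⟩
      obtain rfl : δ = D.boxDelta t := h3
      refine ⟨fun i => (hM z i h1).1, h2.trans (le_of_eq ?_)⟩
      simp only [liftLast]
      congr 1
      funext i
      rw [(hM z i h1).2, ← G_boxDelta b h1]
  -- The entries of `δ` and `δ'` lie in `[0, 1]`, and a proper mixture equal to `0` or `1` forces
  -- both of them to that value.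
  · rintro ⟨⟨z, δ⟩, r⟩ hx ⟨⟨z', δ'⟩, r'⟩ hy α β hα hβ hαβ hF
    have hF' : ∀ i k, α * δ i k + β * δ' i k = D.boxDelta t i k := fun i k =>
      congrFun (congrFun hF i) k
    have : ∀ i k, δ i k = D.boxDelta t i k ∧ δ' i k = D.boxDelta t i k := by
      intro i k
      have h1 := mem_Icc_of_mem_deltaBar hx i k
      have h2 := mem_Icc_of_mem_deltaBar hy i k
      have h3 := hF' i k
      simp only [boxDelta] at h3 ⊢
      obtain rfl : β = 1 - α := by linarith
      split_ifs at h3 ⊢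
      · constructor <;> nlinarith
      · constructor <;> nlinarith
    exact ⟨funext fun i => funext fun k => (this i k).1,
      funext fun i => funext fun k => (this i k).2⟩

end DeltaBar

end DiscretizationScheme

/-! ### Discrete concave envelopes and the least point of a face. -/

theorem convex_simplotope {d n : ℕ} (c : Fin d → Fin (n + 1) → ℝ) : Convex ℝ (simplotope c) := by
  intro x hx y hy α β hα hβ hαβ i
  have h := convex_chain (c i) (hx i) (hy i) hα hβ hαβ
  exact h

theorem convex_setOf_fst {E : Type*} [AddCommGroup E] [Module ℝ E] {K : Set E} (hK : Convex ℝ K) :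
    Convex ℝ {w : E × ℝ | w.1 ∈ K} := hK.linear_preimage (LinearMap.fst ℝ E ℝ)

theorem mem_le_of_concaveOn {A : Set (ℝ × ℝ)} {S : ℝ → ℝ} (hS : ConcaveOn ℝ Set.univ S)
    (hA : ∀ w ∈ A, w.2 ≤ S w.1) {p r : ℝ} (h : (p, r) ∈ convexHull ℝ A) : r ≤ S p :=
  have key : convexHull ℝ A ⊆ {w : ℝ × ℝ | w.1 ∈ Set.univ ∧ w.2 ≤ S w.1} :=
    convexHull_min (fun w hw => ⟨Set.mem_univ _, hA w hw⟩) hS.convex_hypograph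
  (key h).2

/-- The envelope of a real-valued discrete function is real at the points, and it is the smallest
concave majorant. -/
theorem exists_concDiscrete {n : ℕ} (c w : Fin (n + 1) → ℝ) (hc : Monotone c) :
    ∃ s : Fin (n + 1) → ℝ, (∀ j, (s j : EReal) = concDiscrete c (fun k => (w k : EReal)) (c j)) ∧
      w ≤ s ∧ ConcaveAlong c s ∧
      ∀ S : ℝ → ℝ, ConcaveOn ℝ Set.univ S → (∀ j, w j ≤ S (c j)) → ∀ j, s j ≤ S (c j) := by
  set A : Set (ℝ × ℝ) := {q | ∃ j, q.1 = c j ∧ (q.2 : EReal) ≤ (w j : EReal)} with hA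
  have hmem : ∀ j, (c j, w j) ∈ convexHull ℝ A := fun j =>
    subset_convexHull ℝ _ ⟨j, rfl, le_rfl⟩
  have hle : ∀ S : ℝ → ℝ, ConcaveOn ℝ Set.univ S → (∀ j, w j ≤ S (c j)) →
      ∀ j r, (c j, r) ∈ convexHull ℝ A → r ≤ S (c j) := by
    intro S hS h j r hr
    refine mem_le_of_concaveOn hS ?_ hr
    rintro ⟨p, ρ⟩ ⟨k, hk, hρ⟩
    dsimp only at hk hρ
    rw [hk]
    exact (EReal.coe_le_coe_iff.1 hρ).trans (h k)
  -- The constant majorant `B` excludes the value `⊤`; the points `hmem` exclude `⊥`.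
  obtain ⟨B, hB⟩ : ∃ B, ∀ j, w j ≤ B := (Set.finite_range w).bddAbove.imp fun B hB j => hB ⟨j, rfl⟩
  have hreal : ∀ j, ∃ r : ℝ, (r : EReal) = envelope A (c j) := by
    intro j
    have h1 := le_envelope_of_mem (hmem j)
    have h2 : envelope A (c j) ≤ (B : EReal) := by
      refine sSup_le ?_
      rintro _ ⟨r, hr, rfl⟩
      exact EReal.coe_le_coe_iff.2
        (hle (fun _ => B) (concaveOn_const B convex_univ) hB j r hr)
    refine ⟨(envelope A (c j)).toReal, EReal.coe_toReal ?_ ?_⟩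
    · exact fun h => by simp [h] at h2
    · exact fun h => by simp [h] at h1
  choose s hs using hreal
  refine ⟨s, hs, fun j => ?_, ⟨fun i j hij => ?_, fun i j k hij hjk => ?_⟩, fun S hS h j => ?_⟩
  · have := le_envelope_of_mem (hmem j)
    rw [← hs] at this
    exact EReal.coe_le_coe_iff.1 this
  · have : (s i : EReal) = s j := by rw [hs, hs, hij]
    exact EReal.coe_eq_coe_iff.1 this
  · have h1 := hc hij
    have h2 := hc hjk
    rcases eq_or_lt_of_le (h1.trans h2) with h3 | h3
    · have e1 : c i = c j := le_antisymm h1 (h3 ▸ h2)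
      rw [← h3, ← e1]; simp
    · have hd : 0 < c k - c i := sub_pos.2 h3
      have := envelope_concave
        (div_nonneg (by linarith) hd.le : 0 ≤ (c k - c j) / (c k - c i))
        (div_nonneg (by linarith) hd.le : 0 ≤ (c j - c i) / (c k - c i)) (by field_simp; ring)
        (hs i).le (hs k).le
      have e : ((c k - c j) / (c k - c i)) • c i + ((c j - c i) / (c k - c i)) • c k = c j := by
        simp only [smul_eq_mul]; field_simp; ring
      rw [e, ← hs, EReal.coe_le_coe_iff] at this
      calc (c k - c j) * s i + (c j - c i) * s k
          = (c k - c i) * ((c k - c j) / (c k - c i) * s i + (c j - c i) / (c k - c i) * s k) := by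
            field_simp
        _ ≤ _ := mul_le_mul_of_nonneg_left this hd.le
  · have : (s j : EReal) ≤ S (c j) := by
      rw [hs]
      refine sSup_le ?_
      rintro _ ⟨r, hr, rfl⟩
      exact EReal.coe_le_coe_iff.2 (hle S hS h j r hr)
    exact EReal.coe_le_coe_iff.1 this

/-- The smallest element of a face of the chain above given underestimators. -/
theorem exists_least_chain {n : ℕ} {c v : Fin (n + 1) → ℝ} (hc : Monotone c) {p p' : Fin (n + 1)}
    (hp : ∀ j ≤ p, c j = c 0) {g : ℝ} (hg0 : c 0 ≤ g) (hg : g ≤ c p')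
    (hv : ∀ j, v j ≤ min (c j) g) :
    ∃ s ∈ chain c,
      (∀ j, (s j : EReal) = concDiscrete c
        (fun k => ((if k ≤ p then c k else if p' ≤ k then g else v k : ℝ) : EReal)) (c j)) ∧
      ConcaveAlong c s ∧ s p' = s (Fin.last n) ∧ s (Fin.last n) = g ∧ v ≤ s ∧
      ∀ q ∈ chain c, q p' = q (Fin.last n) → q (Fin.last n) = g → v ≤ q → s ≤ q := by
  -- Besides `v`, these are the forced values: a chain point of the face with mean `g` equals `c` up
  -- to `p` and `g` from `p'` on.
  set w : Fin (n + 1) → ℝ := fun k => if k ≤ p then c k else if p' ≤ k then g else v k with hw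
  obtain ⟨s, hs, hws, hconc, hleast⟩ := exists_concDiscrete c w hc
  have hwc : ∀ j, w j ≤ c j := by
    intro j
    simp only [hw]
    split_ifs with h1 h2
    · exact le_rfl
    · exact hg.trans (hc h2)
    · exact (hv j).trans (min_le_left _ _)
  have hwg : ∀ j, w j ≤ g := by
    intro j
    simp only [hw]
    split_ifs with h1 h2
    · rw [hp j h1]; exact hg0
    · exact le_rfl
    · exact (hv j).trans (min_le_right _ _)
  have hvw : ∀ j, v j ≤ w j := by
    intro j
    simp only [hw]
    split_ifs with h1 h2
    · exact (hv j).trans (min_le_left _ _)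
    · exact (hv j).trans (min_le_right _ _)
    · exact le_rfl
  have hsc : ∀ j, s j ≤ c j := hleast id (concaveOn_id convex_univ) hwc
  have hsg : ∀ j, s j ≤ g := hleast (fun _ => g) (concaveOn_const g convex_univ) hwg
  have hs0 : s 0 = c 0 := by
    refine le_antisymm (hsc 0) (le_trans (le_of_eq ?_) (hws 0))
    simp [hw]
  have hright : ∀ j, p' ≤ j → s j = g := by
    intro j hj
    refine le_antisymm (hsg j) ?_
    rcases le_or_gt j p with h | h
    · have h1 : w j = c j := by simp only [hw, if_pos h]
      exact (hg.trans (hc hj)).trans (h1 ▸ hws j)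
    · have h1 : w j = g := by simp only [hw, if_neg (not_le.2 h), if_pos hj]
      exact h1 ▸ hws j
  have hglast : g ≤ c (Fin.last n) := hg.trans (hc (Fin.le_last p'))
  -- Membership of `s` in the chain: the clipped sequence is a chain point above `s` with the same
  -- ends, so `s` is its image under a spread.
  obtain ⟨T, hT, hTs⟩ := exists_isSpread hc (clip_mem_chain hc hg0 hglast) hconc
    (fun j => le_min (hsc j) (hsg j)) (by rw [hs0, min_eq_left hg0])
    (by rw [hright _ (Fin.le_last _), min_eq_right hglast])
  refine ⟨s, hTs ▸ (hT _ (clip_mem_chain hc hg0 hglast)).1, hs, hconc, ?_,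
    hright _ (Fin.le_last _), fun j => (hvw j).trans (hws j), fun q hq hqp hqg hvq => ?_⟩
  · rw [hright _ le_rfl, hright _ (Fin.le_last _)]
  -- A competitor `q` restricts a concave function that majorizes `w`, and the envelope is the least
  -- such.
  · obtain ⟨S, hS, hqS⟩ := chain_exists_concaveOn hc hq
    intro j
    rw [hqS]
    refine hleast S hS (fun k => ?_) j
    rw [← hqS]
    have hm := chain_monotone hc hq
    simp only [hw]
    split_ifs with h1 h2
    · rw [hp k h1, ← chain_zero hq]; exact hm (Fin.zero_le k)
    · rw [← hqg, ← hqp]; exact hm h2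
    · exact hvq k

theorem eq_of_mix_eq {x y X Y α β : ℝ} (hα : 0 < α) (hβ : 0 < β) (hx : x ≤ X) (hy : y ≤ Y)
    (h : α * x + β * y = α * X + β * Y) : x = X ∧ y = Y := by
  have h1 := mul_le_mul_of_nonneg_left hx hα.le
  have h2 := mul_le_mul_of_nonneg_left hy hβ.le
  exact ⟨mul_left_cancel₀ hα.ne' (by linarith), mul_left_cancel₀ hβ.ne' (by linarith)⟩

/-! ### Envelopes over a box, and comparison between boxes. -/

namespace DiscretizationScheme

variable {m d n : ℕ} {D : DiscretizationScheme d n} {X : Set (Fin m → ℝ)}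
  {f : (Fin m → ℝ) → Fin d → ℝ} {u : Fin d → Fin (n + 1) → (Fin m → ℝ) → ℝ} {b : D.Coeff}

/-- The envelope over the simplotope is attained, on the face of a box, by the envelope
over `Δ̄`. -/
theorem concOn_simplotope_le (hb : D.IsAdmissible X f u b) (φ : (Fin d → ℝ) → ℝ) (t : D.BoxIndex)
    {s : Fin d → Fin (n + 1) → ℝ} (hs : ∀ i, s i (D.τ i (t i).succ) = s i (Fin.last n)) :
    concOn (simplotope (D.boxBound b t)) (liftLast φ) s ≤
      concOn D.deltaBar (fun p => liftLast φ (D.G b p))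
        (fun i => slopesOn (D.boxBound b t i) (D.τ i (t i).castSucc) (D.τ i (t i).succ) (s i),
          D.boxDelta t) := by
  have hc := hb.boxBound_monotone t
  refine envelope_le_envelope fun r hr => ?_
  have hface := mem_convexHull_inter_face
    (C := {w : (Fin d → Fin (n + 1) → ℝ) × ℝ | w.1 ∈ simplotope (D.boxBound b t)})
    (F := {w : (Fin d → Fin (n + 1) → ℝ) × ℝ |
      ∀ i, w.1 i (D.τ i (t i).succ) = w.1 i (Fin.last n)})
    (convex_setOf_fst (convex_simplotope _))
    (fun w hw => hw.1) ?_ hr hs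
  · refine mem_convexHull_of_preservesMix
      (Λ := fun s : Fin d → Fin (n + 1) → ℝ => ((fun i => slopesOn (D.boxBound b t i)
        (D.τ i (t i).castSucc) (D.τ i (t i).succ) (s i), D.boxDelta t) : D.ZVar × D.DVar))
      ?_ ?_ hface
    · intro x y α β hαβ
      refine Prod.ext (funext fun i => slopesOn_preservesMix _ _ _ _ _ _ _ hαβ) ?_
      simp only [Prod.snd_add, Prod.smul_snd]
      rw [← add_smul, hαβ, one_smul]
    · rintro ⟨q, r⟩ ⟨⟨h1, h2⟩, h3⟩
      have h4 := slopesOn_mem_deltaBar hc h1 t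
      refine ⟨h4, h2.trans (le_of_eq ?_)⟩
      simp only [liftLast]
      congr 1
      funext i
      rw [G_boxDelta b h4, increment_slopesOn (hc i) (h1 i)
        (fun j hj => hb.chain_eq_boxBound (h1 i) hj) (h3 i)]
  -- Chain points are monotone, so equality of the entries at the right breakpoint and at `n` is an
  -- extreme case of an inequality.
  · rintro ⟨q, r⟩ hx ⟨q', r'⟩ hy α β hα hβ hαβ hF
    have : ∀ i, q i (D.τ i (t i).succ) = q i (Fin.last n) ∧
        q' i (D.τ i (t i).succ) = q' i (Fin.last n) := by
      intro i
      have h1 := chain_monotone (hc i) (hx i) (Fin.le_last (D.τ i (t i).succ))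
      have h2 := chain_monotone (hc i) (hy i) (Fin.le_last (D.τ i (t i).succ))
      have h3 : α * q i (D.τ i (t i).succ) + β * q' i (D.τ i (t i).succ)
        = α * q i (Fin.last n) + β * q' i (Fin.last n) := hF i
      exact eq_of_mix_eq hα hβ h1 h2 h3
    exact ⟨fun i => (this i).1, fun i => (this i).2⟩

/-- The points of the tightened formulation, described by the box that they select. -/
theorem exists_box_of_mem_tight {φ : (Fin d → ℝ) → ℝ} (hb : D.IsAdmissible X f u b)
    {W : Set ((Fin m → ℝ) × (Fin d → ℝ))} {x : Fin m → ℝ} {y : ℝ} {s z : D.ZVar} {δ : D.DVar}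
    (h : (x, y, s, z, δ) ∈ D.tight φ u b W) :
    ∃ t : D.BoxIndex, (z, D.boxDelta t) ∈ D.deltaBar ∧
      (y : EReal) ≤ concOn D.deltaBar (fun p => liftLast φ (D.G b p)) (z, D.boxDelta t) ∧
      (∀ i, s i = increment (D.boxBound b t i) (z i)) ∧ (∀ i, s i ∈ chain (D.boxBound b t i)) ∧
      (∀ i, s i (D.τ i (t i).succ) = s i (Fin.last n)) ∧ (∀ i j, u i j x ≤ s i j) ∧
      D.IsCompatible u (D.boxBound b t) t x (fun i => s i (Fin.last n)) := by
  obtain ⟨⟨h1, h2, h3, h4, -⟩, h5⟩ := h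
  obtain ⟨t, rfl⟩ := exists_eq_boxDelta h3 h5
  have hs : ∀ i, s i = increment (D.boxBound b t i) (z i) := fun i => by
    rw [h2, G_boxDelta b h3]
  have hch : ∀ i, s i ∈ chain (D.boxBound b t i) := fun i => by
    rw [hs]; exact increment_mem_chain _ (steps_of_mem_deltaBar h3 i)
  have hr : ∀ i, s i (D.τ i (t i).succ) = s i (Fin.last n) := fun i => by
    rw [hs]; exact increment_right_eq_last h3 i
  have hc := hb.boxBound_monotone t
  refine ⟨t, h3, h1, hs, hch, hr, h4, fun i => ⟨?_, ?_⟩, fun i => ?_, fun i j => ?_⟩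
  · rw [← hb.boxBound_zero t i, ← chain_zero (hch i)]
    exact chain_monotone (hc i) (hch i) (Fin.zero_le _)
  · rw [← hb.boxBound_last t i]
    exact chain_le (hc i) (hch i) _
  · dsimp only
    rw [← hr]
    exact chain_le (hc i) (hch i) _
  · exact le_min ((h4 i j).trans (chain_le (hc i) (hch i) j))
      ((h4 i j).trans (chain_monotone (hc i) (hch i) (Fin.le_last j)))

/-- A point of the simplotope of one box is dominated by the least point of another box, if
both boxes contain the value `g`. -/
theorem concOn_simplotope_le_of_least (hb : D.IsAdmissible X f u b) (φ : (Fin d → ℝ) → ℝ)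
    {t t' : D.BoxIndex} {g : Fin d → ℝ} (ht : D.InBox t g)
    {s s' : Fin d → Fin (n + 1) → ℝ} (hs : ∀ i, s i ∈ chain (D.boxBound b t' i))
    (hsg : ∀ i, s i (Fin.last n) = g i) (hs' : ∀ i, s' i ∈ chain (D.boxBound b t i))
    (hsg' : ∀ i, s' i (Fin.last n) = g i)
    (hle : ∀ i, t' i = t i → s' i ≤ s i) :
    concOn (simplotope (D.boxBound b t')) (liftLast φ) s ≤
      concOn (simplotope (D.boxBound b t)) (liftLast φ) s' := by
  have hc := hb.boxBound_monotone
  have hsame : ∀ i, t' i = t i → D.boxBound b t' i = D.boxBound b t i := fun i h => by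
    unfold boxBound; rw [h]
  have hT : ∀ i, ∃ T : (Fin (n + 1) → ℝ) →ₗ[ℝ] (Fin (n + 1) → ℝ),
      t' i = t i → IsSpread (D.boxBound b t i) T ∧ T (s i) = s' i := by
    intro i
    by_cases h : t' i = t i
    · have h1 : s i ∈ chain (D.boxBound b t i) := hsame i h ▸ hs i
      obtain ⟨T, hT⟩ := exists_isSpread (hc t i) h1 (chain_concaveAlong (hc t i) (hs' i)) (hle i h)
        (by rw [chain_zero h1, chain_zero (hs' i)]) (by rw [hsg, hsg'])
      exact ⟨T, fun _ => hT⟩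
    · exact ⟨0, fun h' => absurd h' h⟩
  choose T hT using hT
  refine envelope_le_envelope fun r hr => ?_
  have hface := mem_convexHull_inter_face
    (C := {w : (Fin d → Fin (n + 1) → ℝ) × ℝ | w.1 ∈ simplotope (D.boxBound b t')})
    (F := {w : (Fin d → Fin (n + 1) → ℝ) × ℝ | ∀ i, t' i ≠ t i → w.1 i (Fin.last n) = g i})
    (convex_setOf_fst (convex_simplotope _))
    (fun w hw => hw.1) ?_ hr (fun i _ => hsg i)
  · classical
    have e : (fun i => if t' i = t i then T i (s i) else s' i) = s' := by
      funext i
      split_ifs with h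
      · exact (hT i h).2
      · rfl
    rw [← e]
    refine mem_convexHull_of_preservesMix
      -- Coordinates with the same interval are spread; the others become the constant `s' i`, which
      -- keeps `φ̄` because on the face their last entry is `g i`.
      (Λ := fun q : Fin d → Fin (n + 1) → ℝ => fun i => if t' i = t i then T i (q i) else s' i)
      ?_ ?_ hface
    · intro x y α β hαβ
      funext i
      simp only [Pi.add_apply, Pi.smul_apply]
      split_ifs
      · simp
      · rw [← add_smul, hαβ, one_smul]
    · rintro ⟨q, r⟩ ⟨⟨h1, h2⟩, h3⟩
      refine ⟨fun i => ?_, h2.trans (le_of_eq ?_)⟩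
      · dsimp only
        split_ifs with h
        · exact ((hT i h).1 _ (hsame i h ▸ h1 i)).1
        · exact hs' i
      · simp only [liftLast]
        congr 1
        funext i
        split_ifs with h
        · exact ((hT i h).1 _ (hsame i h ▸ h1 i)).2.symm
        · rw [hsg']; exact h3 i h
  · rintro ⟨q, r⟩ hx ⟨q', r'⟩ hy α β hα hβ hαβ hF
    have hq : ∀ i, q i ∈ chain (D.boxBound b t' i) := hx
    have hq' : ∀ i, q' i ∈ chain (D.boxBound b t' i) := hy
    have : ∀ i, t' i ≠ t i → q i (Fin.last n) = g i ∧ q' i (Fin.last n) = g i := by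
      intro i hi
      have h3 := hF i hi
      simp only [Prod.fst_add, Prod.smul_fst, Pi.add_apply, Pi.smul_apply, smul_eq_mul] at h3
      have hg : α * g i + β * g i = g i := by rw [← add_mul, hαβ, one_mul]
      have hmono := (D.a_strictMono i).monotone.comp (D.τ_strictMono i).monotone
      -- The intervals `t' i` and `t i` overlap at most in an end, so `g i` bounds the last entries
      -- over the box `t'` from above or from below.
      rcases lt_or_gt_of_ne hi with h | h
      · have h4 : D.a i (D.τ i (t' i).succ) ≤ g i :=
          (hmono (Fin.succ_le_castSucc_iff.2 h)).trans (ht i).1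
        rw [← hb.boxBound_last t' i] at h4
        exact eq_of_mix_eq hα hβ ((chain_le (hc t' i) (hq i) _).trans h4)
          ((chain_le (hc t' i) (hq' i) _).trans h4) (h3.trans hg.symm)
      · have h4 : g i ≤ D.a i (D.τ i (t' i).castSucc) :=
          (ht i).2.trans (hmono (Fin.succ_le_castSucc_iff.2 h))
        rw [← hb.boxBound_zero t' i] at h4
        have h5 := chain_monotone (hc t' i) (hq i) (Fin.zero_le (Fin.last n))
        have h6 := chain_monotone (hc t' i) (hq' i) (Fin.zero_le (Fin.last n))
        rw [chain_zero (hq i)] at h5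
        rw [chain_zero (hq' i)] at h6
        have := eq_of_mix_eq hα hβ (h4.trans h5) (h4.trans h6) (hg.trans h3.symm)
        exact ⟨this.1.symm, this.2.symm⟩
    exact ⟨fun i hi => (this i hi).1, fun i hi => (this i hi).2⟩

/-- Compatibility puts `u` below both `a'` and `g`, so outside the open piece the prescribed value
wins the maximum and inside it `u` faces only `⊥`. The index `n` is never before the right
breakpoint, so the exceptional last entry agrees. -/
theorem uTilde_eq {a' : Fin d → Fin (n + 1) → ℝ} {t : D.BoxIndex} {x : Fin m → ℝ} {g : Fin d → ℝ}
    (h : D.IsCompatible u a' t x g) (i : Fin d) :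
    D.uTilde u a' t x g i = fun k => ((if k ≤ D.τ i (t i).castSucc then a' i k else
      if D.τ i (t i).succ ≤ k then g i else u i k x : ℝ) : EReal) := by
  funext j
  have hu := h.2.2 i j
  have h1 : u i j x ≤ a' i j := hu.trans (min_le_left _ _)
  have h2 : u i j x ≤ g i := hu.trans (min_le_right _ _)
  unfold uTilde
  split_ifs with h3 h4 h5 h4 h5
  all_goals first
    | exact absurd h3 ((h4.trans_lt (left_lt_right i (t i))).trans_le (Fin.le_last _)).ne
    | exact max_self _
    | exact max_eq_right (EReal.coe_le_coe_iff.2 ‹_›)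
    | exact max_eq_left bot_le
    | (subst h3; exact absurd (Fin.le_last _) h5)

theorem exists_least (hb : D.IsAdmissible X f u b) {t : D.BoxIndex} {x : Fin m → ℝ}
    {g : Fin d → ℝ} (h : D.IsCompatible u (D.boxBound b t) t x g) :
    ∃ s : Fin d → Fin (n + 1) → ℝ,
      (∀ i j, (s i j : EReal) = concDiscrete (D.boxBound b t i)
        (D.uTilde u (D.boxBound b t) t x g i) (D.boxBound b t i j)) ∧
      (∀ i, s i ∈ chain (D.boxBound b t i)) ∧
      (∀ i, s i (D.τ i (t i).succ) = s i (Fin.last n)) ∧ (∀ i, s i (Fin.last n) = g i) ∧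
      (∀ i j, u i j x ≤ s i j) ∧
      ∀ i, ∀ q ∈ chain (D.boxBound b t i), q (D.τ i (t i).succ) = q (Fin.last n) →
        q (Fin.last n) = g i → (∀ j, u i j x ≤ q j) → s i ≤ q := by
  have := fun i => exists_least_chain (v := fun j => u i j x) (hb.boxBound_monotone t i)
    (fun j hj => hb.boxBound_of_le t i hj) (by rw [hb.boxBound_zero]; exact (h.1 i).1) (h.2.1 i)
    (h.2.2 i)
  choose s h1 h2 h3 h4 h5 h6 h7 using this
  refine ⟨s, fun i j => ?_, h1, h4, h5, h6, h7⟩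
  rw [h2, uTilde_eq h]

end DiscretizationScheme

/-! ### Convexity, validity, exact values, and the comparison with the global bounds. -/

namespace DiscretizationScheme

variable {m d n : ℕ} {D : DiscretizationScheme d n} {X : Set (Fin m → ℝ)}
  {f : (Fin m → ℝ) → Fin d → ℝ} {u : Fin d → Fin (n + 1) → (Fin m → ℝ) → ℝ} {b : D.Coeff}

theorem G_preservesMix (b : D.Coeff) : PreservesMix (D.G b) := by
  intro x y α β h
  funext i j
  have h1 : ∀ q : Fin n, ∀ C : ℝ,
      (if q.succ ≤ j then (α * x.1 i q.succ + β * y.1 i q.succ) * C else 0)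
      = α * (if q.succ ≤ j then x.1 i q.succ * C else 0)
        + β * (if q.succ ≤ j then y.1 i q.succ * C else 0) := fun q C => by
    split_ifs <;> ring
  have h2 : ∀ (k : Fin (D.l i + 1)) (C : ℝ), (α * x.2 i k + β * y.2 i k) * C
      = α * (x.2 i k * C) + β * (y.2 i k * C) := fun k C => by ring
  simp only [G, Prod.fst_add, Prod.snd_add, Prod.smul_fst, Prod.smul_snd, Pi.add_apply,
    Pi.smul_apply, smul_eq_mul, h1, h2, Finset.sum_add_distrib, ← Finset.mul_sum]
  have h3 : D.a i 0 = α * D.a i 0 + β * D.a i 0 := by rw [← add_mul, h, one_mul]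
  linear_combination h3

theorem convex_tightContinuous (φ : (Fin d → ℝ) → ℝ) (b : D.Coeff)
    {W : Set ((Fin m → ℝ) × (Fin d → ℝ))} (hW : Convex ℝ W)
    (hu : ∀ i j, ConvexOn ℝ (Prod.fst '' W) (u i j)) :
    Convex ℝ (D.tightContinuous φ u b W) := by
  rintro ⟨x, y, s, z, δ⟩ ⟨h1, h2, h3, h4, h5⟩ ⟨x', y', s', z', δ'⟩ ⟨h1', h2', h3', h4', h5'⟩
    α β hα hβ hαβ
  refine ⟨envelope_concave hα hβ hαβ h1 h1', ?_, convex_deltaBar h3 h3' hα hβ hαβ,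
    fun i j => ?_, hW h5 h5' hα hβ hαβ⟩
  · have := G_preservesMix b (z, δ) (z', δ') α β hαβ
    rw [← h2, ← h2'] at this
    exact this.symm
  · have h6 := (hu i j).2 ⟨_, h5, rfl⟩ ⟨_, h5', rfl⟩ hα hβ hαβ
    exact h6.trans (add_le_add (mul_le_mul_of_nonneg_left (h4 i j) hα)
      (mul_le_mul_of_nonneg_left (h4' i j) hβ))

theorem isBinary_boxDelta (t : D.BoxIndex) : D.IsBinary (D.boxDelta t) := fun i k => by
  simp only [boxDelta]
  split_ifs <;> simp

/-- Points of the simplotope of a box lift to points of the tightened formulation. -/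
theorem mem_tight_of_mem_simplotope {φ : (Fin d → ℝ) → ℝ} (hb : D.IsAdmissible X f u b)
    {W : Set ((Fin m → ℝ) × (Fin d → ℝ))} {x : Fin m → ℝ} {y : ℝ} (t : D.BoxIndex)
    {s : Fin d → Fin (n + 1) → ℝ} (hs : ∀ i, s i ∈ chain (D.boxBound b t i))
    (hr : ∀ i, s i (D.τ i (t i).succ) = s i (Fin.last n)) (hu : ∀ i j, u i j x ≤ s i j)
    (hW : (x, fun i => s i (Fin.last n)) ∈ W)
    (hy : (y : EReal) ≤ concOn (simplotope (D.boxBound b t)) (liftLast φ) s) :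
    (x, y, s, (fun i => slopesOn (D.boxBound b t i) (D.τ i (t i).castSucc) (D.τ i (t i).succ)
      (s i)), D.boxDelta t) ∈ D.tight φ u b W := by
  have hc := hb.boxBound_monotone t
  have h := slopesOn_mem_deltaBar hc hs t
  refine ⟨⟨hy.trans (concOn_simplotope_le hb φ t hr), funext fun i => ?_, h, hu, hW⟩,
    isBinary_boxDelta t⟩
  rw [G_boxDelta b h, increment_slopesOn (hc i) (hs i)
    (fun j hj => hb.chain_eq_boxBound (hs i) hj) (hr i)]

/-- The half-open pieces miss only the point `a_i0`, which the second alternative covers. The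
assumption `1 ≤ n` ensures that there is a piece at all. -/
theorem exists_piece (D : DiscretizationScheme d n) (hn : 1 ≤ n) (i : Fin d) {v : ℝ}
    (h0 : D.a i 0 ≤ v) (h1 : v ≤ D.a i (Fin.last n)) :
    ∃ t : Fin (D.l i), D.InPiece i t v ∨ (v = D.a i (D.τ i t.castSucc)) := by
  rcases eq_or_lt_of_le h0 with h | h
  · have hl : D.l i ≠ 0 := by
      intro hl
      have e : Fin.last (D.l i) = 0 := by ext; simp [hl]
      have := D.τ_last i
      rw [e, D.τ_zero] at this
      have := congrArg Fin.val this
      simp at this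
      omega
    refine ⟨⟨0, Nat.pos_of_ne_zero hl⟩, Or.inr ?_⟩
    have e : (⟨0, Nat.pos_of_ne_zero hl⟩ : Fin (D.l i)).castSucc = 0 := rfl
    rw [e, D.τ_zero, h]
  · have key : ∀ k : Fin (D.l i + 1), v ≤ D.a i (D.τ i k) → ∃ t : Fin (D.l i), D.InPiece i t v := by
      intro k
      induction k using Fin.induction with
      | zero => intro h'; rw [D.τ_zero] at h'; exact absurd h (not_lt.2 h')
      | succ k ih =>
        intro h'
        rcases le_or_gt v (D.a i (D.τ i k.castSucc)) with h2 | h2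
        · exact ih h2
        · exact ⟨k, h2, h'⟩
    obtain ⟨t, ht⟩ := key (Fin.last _) (by rw [D.τ_last]; exact h1)
    exact ⟨t, Or.inl ht⟩

/-- The points of `X` are compatible with some box. -/
theorem exists_isCompatible (hn : 1 ≤ n) (hu : OrderedOA X f D.a u)
    (hb : D.IsAdmissible X f u b) {x : Fin m → ℝ} (hx : x ∈ X) :
    ∃ t : D.BoxIndex, D.IsCompatible u (D.boxBound b t) t x (f x) := by
  have h0 : ∀ i, D.a i 0 ≤ f x i := fun i => hu.first x hx i ▸ hu.le_inner x hx i 0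
  have h1 : ∀ i, f x i ≤ D.a i (Fin.last n) := fun i => hu.last x hx i ▸ hu.le_bound x hx i _
  choose t ht using fun i => D.exists_piece hn i (h0 i) (h1 i)
  have hmono := fun i => (D.a_strictMono i).monotone (left_lt_right i (t i)).le
  -- At the left end the admissibility conditions for pieces say nothing, but there `f x i` is the
  -- smallest local bound.
  have hge : ∀ i j, f x i = D.a i (D.τ i (t i).castSucc) → f x i ≤ D.boxBound b t i j := by
    intro i j h
    rw [h, ← hb.boxBound_zero]
    exact hb.boxBound_monotone t i (Fin.zero_le j)
  refine ⟨t, fun i => ?_, fun i => ?_, fun i j => ?_⟩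
  · rcases ht i with h | h
    · exact ⟨h.1.le, h.2⟩
    · exact ⟨h.ge, h.le.trans (hmono i)⟩
  · rcases ht i with h | h
    · exact hb.inner_le x hx i (t i) h
    · exact hge i _ h
  · refine le_min ?_ (hu.le_inner x hx i j)
    rcases ht i with h | h
    · exact hb.under_le x hx i (t i) h j
    · exact (hu.le_inner x hx i j).trans (hge i j h)

/-- The formulation contains the hypograph of `φ ∘ f`. -/
theorem exists_mem_tight (hn : 1 ≤ n) (φ : (Fin d → ℝ) → ℝ) (hu : OrderedOA X f D.a u)
    (hb : D.IsAdmissible X f u b) {W : Set ((Fin m → ℝ) × (Fin d → ℝ))}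
    {x : Fin m → ℝ} (hx : x ∈ X) (hW : (x, f x) ∈ W) {y : ℝ} (hy : y ≤ φ (f x)) :
    ∃ s z δ, (x, y, s, z, δ) ∈ D.tight φ u b W := by
  obtain ⟨t, ht⟩ := exists_isCompatible hn hu hb hx
  have hc := hb.boxBound_monotone t
  have hg : ∀ i j, D.τ i (t i).succ ≤ j → min (D.boxBound b t i j) (f x i) = f x i :=
    fun i j hj => min_eq_right ((ht.2.1 i).trans (hc i hj))
  have hlast : (fun i => min (D.boxBound b t i (Fin.last n)) (f x i)) = f x :=
    funext fun i => hg i _ (Fin.le_last _)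
  -- The witness is the largest chain point with mean `f x i`. It lies in the simplotope itself, so
  -- no proper mixture is needed for the height.
  have hs : ∀ i, (fun j => min (D.boxBound b t i j) (f x i)) ∈ chain (D.boxBound b t i) :=
    fun i => clip_mem_chain (hc i) (by rw [hb.boxBound_zero]; exact (ht.1 i).1)
      ((ht.2.1 i).trans (hc i (Fin.le_last _)))
  refine ⟨_, _, _, mem_tight_of_mem_simplotope hb t hs
    (fun i => (hg i _ le_rfl).trans (hg i _ (Fin.le_last _)).symm) ht.2.2 ?_ ?_⟩
  · rw [hlast]; exact hW
  · refine le_envelope_of_mem (subset_convexHull ℝ _ ⟨hs, ?_⟩)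
    simp only [liftLast, hlast]
    exact hy

/-- The values of the formulation over a compatible point. -/
theorem mem_tightValues_iff (hb : D.IsAdmissible X f u b) (φ : (Fin d → ℝ) → ℝ)
    {W : Set ((Fin m → ℝ) × (Fin d → ℝ))} {x : Fin m → ℝ} {g : Fin d → ℝ} (hW : (x, g) ∈ W)
    {t : D.BoxIndex} (ht : D.IsCompatible u (D.boxBound b t) t x g)
    {s : Fin d → Fin (n + 1) → ℝ} (hs : ∀ i, s i ∈ chain (D.boxBound b t i))
    (hr : ∀ i, s i (D.τ i (t i).succ) = s i (Fin.last n)) (hg : ∀ i, s i (Fin.last n) = g i)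
    (hu : ∀ i j, u i j x ≤ s i j)
    (hleast : ∀ i, ∀ q ∈ chain (D.boxBound b t i), q (D.τ i (t i).succ) = q (Fin.last n) →
        q (Fin.last n) = g i → (∀ j, u i j x ≤ q j) → s i ≤ q) (y : ℝ) :
    y ∈ D.tightValues φ u b W x g ↔
      (y : EReal) ≤ concOn (simplotope (D.boxBound b t)) (liftLast φ) s := by
  constructor
  · rintro ⟨q, z, δ, hq, hqg⟩
    obtain ⟨t', h1, h2, h3, h4, h5, h6, -⟩ := exists_box_of_mem_tight hb hq
    have h7 := concOn_deltaBar_le φ b t' (D.boxBound b t')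
      (M := fun i => increment (D.boxBound b t' i))
      (fun z i hz => ⟨increment_mem_chain _ (steps_of_mem_deltaBar hz i), rfl⟩) z
    have e : (fun i => increment (D.boxBound b t' i) (z i)) = q := funext fun i => (h3 i).symm
    rw [e] at h7
    refine (h2.trans h7).trans (concOn_simplotope_le_of_least hb φ ht.1 h4 hqg hs hg ?_)
    intro i hi
    have e1 : D.boxBound b t' i = D.boxBound b t i := by unfold boxBound; rw [hi]
    exact hleast i _ (e1 ▸ h4 i) (hi ▸ h5 i) (hqg i) (h6 i)
  · intro hy
    have hW' : (x, fun i => s i (Fin.last n)) ∈ W := by rw [funext hg]; exact hW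
    exact ⟨_, _, _, mem_tight_of_mem_simplotope hb t hs hr hu hW' hy, hg⟩

/-- The formulation with the local bounds is at least as tight as that with the global bounds. -/
theorem tightValues_subset_baseValues (hb : D.IsAdmissible X f u b) (φ : (Fin d → ℝ) → ℝ)
    (W : Set ((Fin m → ℝ) × (Fin d → ℝ))) {x : Fin m → ℝ} (g : Fin d → ℝ)
    (hu : ∀ i j, u i j x ≤ D.a i j) :
    D.tightValues φ u b W x g ⊆ D.baseValues φ u W x g := by
  rintro y ⟨s, z, δ, hmem, hg⟩
  obtain ⟨t, h1, h2, h3, h4, h5, h6, -⟩ := exists_box_of_mem_tight hb hmem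
  have hc := hb.boxBound_monotone t
  have ha := fun i => (D.a_strictMono i).monotone
  have hlow : ∀ i k, D.a i (D.τ i (t i).castSucc) ≤ D.boxBound b t i k := fun i k => by
    rw [← hb.boxBound_zero]; exact hc i (Fin.zero_le k)
  have hhigh : ∀ i k, D.boxBound b t i k ≤ D.a i (D.τ i (t i).succ) := fun i k => by
    rw [← hb.boxBound_last]; exact hc i (Fin.le_last k)
  -- the law on the local bounds with the parameters `z`, spread to adjacent global bounds
  let M : Fin d → (Fin (n + 1) → ℝ) →ₗ[ℝ] (Fin (n + 1) → ℝ) := fun i =>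
    LinearMap.pi fun j => LinearMap.proj (Fin.last n) ∘ₗ
      increment fun k => min (D.a i j) (D.boxBound b t i k)
  have hM : ∀ i z j, M i z j =
    increment (fun k => min (D.a i j) (D.boxBound b t i k)) z (Fin.last n) := fun _ _ _ => rfl
  have hMstep : ∀ i m j, M i (step m) j = min (D.a i j) (D.boxBound b t i m) := fun i m j => by
    rw [hM, increment_step, stair, min_eq_left (Fin.le_last m)]
  have hMchain : ∀ i, ∀ z ∈ steps n, M i z ∈ chain (D.a i) := by
    intro i z hz
    refine steps_subset ((convex_chain (D.a i)).linear_preimage (M i)) (fun m => ?_) hz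
    have e : M i (step m) = fun j => min (D.a i j) (D.boxBound b t i m) :=
      funext fun j => hMstep i m j
    rw [Set.mem_preimage, e]
    exact clip_mem_chain (ha i) ((ha i (Fin.zero_le _)).trans (hlow i m))
      ((hhigh i m).trans (ha i (Fin.le_last _)))
  have hMright : ∀ i z j, D.τ i (t i).succ ≤ j →
      M i z j = increment (D.boxBound b t i) z (Fin.last n) := by
    intro i z j hj
    have e : (fun k => min (D.a i j) (D.boxBound b t i k)) = D.boxBound b t i :=
      funext fun k => min_eq_right ((hhigh i k).trans (ha i hj))
    rw [hM, e]
  have hMleft : ∀ i, ∀ z ∈ steps n, ∀ j, j ≤ D.τ i (t i).castSucc → M i z j = D.a i j := by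
    intro i z hz j hj
    have e : (fun k => min (D.a i j) (D.boxBound b t i k)) = fun _ => D.a i j :=
      funext fun k => min_eq_left ((ha i hj).trans (hlow i k))
    rw [hM, e, increment_apply, hz.1]
    simp
  -- From the left breakpoint on, the local bound is at most `a_j`, so `E min(ξ, a'_j) ≤ E min(ξ,
  -- a_j)`.
  have hMge : ∀ i, ∀ z ∈ steps n, ∀ j, D.τ i (t i).castSucc ≤ j →
      increment (D.boxBound b t i) z j ≤ M i z j := by
    intro i z hz j hj
    refine steps_subset (K := {z | increment (D.boxBound b t i) z j ≤ M i z j}) ?_ (fun m => ?_) hz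
    · intro x hx y hy α β hα hβ _
      simp only [Set.mem_ofPred_eq, map_add, map_smul, Pi.add_apply, Pi.smul_apply, smul_eq_mul]
      exact add_le_add (mul_le_mul_of_nonneg_left hx hα) (mul_le_mul_of_nonneg_left hy hβ)
    · rw [Set.mem_ofPred_eq, hMstep, increment_step, stair]
      exact le_min ((hc i (min_le_right _ _)).trans (hb.boxBound_le t i hj))
        (hc i (min_le_left _ _))
  have h7 := concOn_deltaBar_le φ b t D.a (M := M)
    (fun z i hz => ⟨hMchain i _ (steps_of_mem_deltaBar hz i),
      hMright i _ _ (Fin.le_last _)⟩) z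
  have hz := steps_of_mem_deltaBar h1
  have hlast : ∀ i, M i (z i) (Fin.last n) = s i (Fin.last n) := fun i => by
    rw [hMright i _ _ (Fin.le_last _), h3]
  refine ⟨fun i => M i (z i), D.boxDelta t, ⟨h2.trans h7, ⟨_, funext fun i => ?_,
    slopesOn_mem_deltaBar ha (fun i => hMchain i _ (hz i)) t⟩, isBinary_boxDelta t,
    fun i j => ?_, ?_⟩, fun i => (hlast i).trans (hg i)⟩
  · exact (increment_slopesOn (ha i) (hMchain i _ (hz i)) (hMleft i _ (hz i))
      ((hMright i _ _ le_rfl).trans (hMright i _ _ (Fin.le_last _)).symm)).symm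
  -- Before the left breakpoint the new point equals `a_j`, and `u ≤ a` suffices; after it the new
  -- point dominates `s`.
  · rcases le_total j (D.τ i (t i).castSucc) with hj | hj
    · exact (hu i j).trans (hMleft i _ (hz i) j hj).ge
    · refine (h6 i j).trans ?_
      rw [h3]
      exact hMge i _ (hz i) j hj
  · simp only [hlast]
    exact hmem.1.2.2.2.2

theorem supValue_eq_of_mem_iff {A : Set ℝ} {C : EReal} (h : ∀ y : ℝ, y ∈ A ↔ (y : EReal) ≤ C) :
    supValue A = C := by
  refine le_antisymm (sSup_le ?_) (EReal.ge_of_forall_gt_iff_ge.1 fun z hz => ?_)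
  · rintro _ ⟨r, hr, rfl⟩
    exact (h r).1 hr
  · exact le_sSup ⟨z, (h z).2 (le_of_lt hz), rfl⟩

end DiscretizationScheme

theorem mainTheorem4 {m d n : ℕ} (hn : 1 ≤ n)
    (X : Set (Fin m → ℝ)) (f : (Fin m → ℝ) → Fin d → ℝ) (φ : (Fin d → ℝ) → ℝ)
    (D : DiscretizationScheme d n)
    (u : Fin d → Fin (n + 1) → (Fin m → ℝ) → ℝ) (hu : OrderedOA X f D.a u)
    (b : D.Coeff) (hb : D.IsAdmissible X f u b)
    (W : Set ((Fin m → ℝ) × (Fin d → ℝ))) (hWconv : Convex ℝ W)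
    (hW : ∀ x ∈ X, (x, f x) ∈ W) :
    -- the continuous relaxation is convex
    ((∀ i j, ConvexOn ℝ (Prod.fst '' W) (u i j)) → Convex ℝ (D.tightContinuous φ u b W)) ∧
    -- the hypograph of `φ ∘ f` is contained in the projection of the formulation
    (∀ x ∈ X, ∀ y : ℝ, y ≤ φ (f x) → ∃ s z δ, (x, y, s, z, δ) ∈ D.tight φ u b W) ∧
    ∀ (x : Fin m → ℝ) (g : Fin d → ℝ), (x, g) ∈ W →
      -- the value of the relaxation at `(x, g)`
      (∀ (t : D.BoxIndex) (a' : Fin d → Fin (n + 1) → ℝ),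
        a' = D.localBound b (D.boxDelta t) → D.IsCompatible u a' t x g →
        ∃ s' : Fin d → Fin (n + 1) → ℝ,
          (∀ i j, (s' i j : EReal) = concDiscrete (a' i) (D.uTilde u a' t x g i) (a' i j)) ∧
          DiscretizationScheme.supValue (D.tightValues φ u b W x g) =
            concOn (simplotope a') (liftLast φ) s' ∧
          ∀ v : ℝ, concOn (simplotope a') (liftLast φ) s' = (v : EReal) →
            IsGreatest (D.tightValues φ u b W x g) v) ∧
      -- there is no feasible point over `(x, g)` if no subcube is compatible with `(x, g)`
      ((∀ t : D.BoxIndex, ¬ D.IsCompatible u (D.localBound b (D.boxDelta t)) t x g) →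
        D.tightValues φ u b W x g = ∅) ∧
      -- comparison with the relaxation that uses the global bounds
      ((∀ i j, u i j x ≤ D.a i j) →
        DiscretizationScheme.supValue (D.tightValues φ u b W x g) ≤
          DiscretizationScheme.supValue (D.baseValues φ u W x g)) := by
  refine ⟨DiscretizationScheme.convex_tightContinuous φ b hWconv, fun x hx y hy =>
    DiscretizationScheme.exists_mem_tight hn φ hu hb hx (hW x hx) hy, fun x g hxg => ⟨?_, ?_, ?_⟩⟩
  · rintro t a' rfl ht
    rw [DiscretizationScheme.localBound_boxDelta] at ht ⊢
    obtain ⟨s, hs, h1, h2, h3, h4, h5⟩ := DiscretizationScheme.exists_least hb ht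
    have hiff := DiscretizationScheme.mem_tightValues_iff hb φ hxg ht h1 h2 h3 h4 h5
    refine ⟨s, hs, DiscretizationScheme.supValue_eq_of_mem_iff hiff,
      fun v hv => ⟨?_, fun y hy => ?_⟩⟩
    · exact (hiff v).2 hv.ge
    · exact EReal.coe_le_coe_iff.1 (hv ▸ (hiff y).1 hy)
  · intro h
    refine Set.eq_empty_of_forall_notMem ?_
    rintro y ⟨s, z, δ, hmem, hg⟩
    obtain ⟨t, -, -, -, -, -, -, ht⟩ := DiscretizationScheme.exists_box_of_mem_tight hb hmem
    rw [funext hg, ← DiscretizationScheme.localBound_boxDelta] at ht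
    exact h t ht
  · intro h
    exact sSup_le_sSup (Set.image_mono
      (DiscretizationScheme.tightValues_subset_baseValues hb φ W g h))
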